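/- Let $k\ge 1$ be an integer, $b\in C^2[0,1]$ and $d\in C[0,1]$ with $b>0$ and $d-\tfrac12 b''>\delta>0$ on $[0,1]$, and let $\alpha_1,C_0$ be constants. There is a constant $C$, depending only on $k,b,d,\delta,\alpha_1,C_0$ (in particular not on $\varepsilon$, $H$ or the mesh), such that the following holds. Let $\varepsilon>0$ and let $u\in C^4[0,1]$ solve $$\varepsilon^2u^{(4)}-bu''+du=f \ \text{ in } (0,1),\qquad u(0)=u'(0)=u(1)=u'(1)=0 .$$ Suppose $u=S+E_1+E_2$ with $S,E_1,E_2\in C^{k+2}[0,1]$ and, for $0\le j\le k+2$ and $x\in[0,1]$, $$|S^{(j)}(x)|\le C_0,\qquad |E_1^{(j)}(x)|\le C_0\varepsilon^{1-j}e^{-x/\varepsilon},\qquad |E_2^{(j)}(x)|\le C_0\varepsilon^{1-j}e^{-(1-x)/\varepsilon}.$$ Put $w=\varepsilon u''$ and $\tau=\varepsilon^{1-1/(2k)}$. Let $0=x_0<\dots<x_N=1$ be a mesh which is equidistant with mesh size $h=\alpha H\varepsilon^{1-1/(2k)}$, $0<\alpha\le\alpha_1$, on each of $[0,\tau]$ and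 $[1-\tau,1]$, and equidistant with mesh size $H>0$ on $[\tau,1-\tau]$ (so that $\tau<1/2$ and $\tau/h$ and $(1-2\tau)/H$ are positive integers). Let $V_H$ be the space of continuous functions on $[0,1]$ that are polynomials of degree at most $k$ on each cell, and $V_{H,0}=\{v\in V_H: v(0)=v(1)=0\}$. With $(\cdot,\cdot)$ the inner product of $L_2(0,1)$, the mixed finite element problem: find $(u_H,w_H)\in V_{H,0}\times V_H$ with $$\varepsilon(u_H',\varphi')+(w_H,\varphi)=0\quad\forall \varphi\in V_H,$$ $$(bu_H',\psi')+(b'u_H',\psi)+(du_H,\psi)-\varepsilon(w_H',\psi')=(f,\psi)\quad\forall\psi\in V_{H,0},$$ has exactly one solution. Let $s\in\{0,1\}$. For every $v\in C[0,1]$ there is exactly one $\pi v\in V_H$ with $(\pi v)(x_i)=v(x_i)$ for $0\le i\le N$ and $$\int_{x_{i-1}}^{x_i}(x-x_{i-1})^l\,\pi v\,dx=\int_{x_{i-1}}^{x_i}(x-x_{i-1})^l\,v\,dx,\qquad 1\le i\le N,\quad s\le l\le s+k-2$$ (no moment condition if $k=1$). In the norm $\|(v,z)\|_1=\big(\|v'\|_{L_2(0,1)}^2+\|z\|_{L_2(0,1)}^2\big)^{1/2}$,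 $$\|(\pi u-u_H,\pi w-w_H)\|_1\le C H^k\qquad\text{and}\qquad \|(u-u_H,w-w_H)\|_1\le C H^k .$$ -/

import Mathlib

open Set

noncomputable section

/-- The closed interval `[0,1]` on which the boundary value problem is posed. -/
abbrev unitI : Set ℝ := Set.Icc (0 : ℝ) 1

/-- The `j`-th derivative of a function on `[0,1]` (one-sided at the end points). -/
abbrev derivI (j : ℕ) (v : ℝ → ℝ) (x : ℝ) : ℝ := iteratedDerivWithin j v unitI x

/-- `u ∈ C⁴[0,1]` solves `ε² u'''' - b u'' + d u = f` in `(0,1)` with the clamped boundary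
conditions `u(0) = u'(0) = u(1) = u'(1) = 0`. -/
structure IsClampedSolution (ε : ℝ) (b d f u : ℝ → ℝ) : Prop where
  smooth : ContDiffOn ℝ 4 u unitI
  equation : ∀ x ∈ Set.Ioo (0 : ℝ) 1,
    ε ^ 2 * derivI 4 u x - b x * derivI 2 u x + d x * u x = f x
  left_value : u 0 = 0
  left_slope : derivI 1 u 0 = 0
  right_value : u 1 = 0
  right_slope : derivI 1 u 1 = 0

/-- `u = S + E₁ + E₂` on `[0,1]` with, for all orders `j ≤ r`,
`|S^{(j)}| ≤ C₀`, `|E₁^{(j)}(x)| ≤ C₀ ε^{1-j} e^{-x/ε}`,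
`|E₂^{(j)}(x)| ≤ C₀ ε^{1-j} e^{-(1-x)/ε}`. -/
structure IsLayerDecomposition (r : ℕ) (C₀ ε : ℝ) (u S E₁ E₂ : ℝ → ℝ) : Prop where
  smooth_S : ContDiffOn ℝ r S unitI
  smooth_E₁ : ContDiffOn ℝ r E₁ unitI
  smooth_E₂ : ContDiffOn ℝ r E₂ unitI
  sum_eq : ∀ x ∈ unitI, u x = S x + E₁ x + E₂ x
  bound_S : ∀ j ≤ r, ∀ x ∈ unitI, |derivI j S x| ≤ C₀
  bound_E₁ : ∀ j ≤ r, ∀ x ∈ unitI,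
    |derivI j E₁ x| ≤ C₀ * ε ^ (1 - (j : ℤ)) * Real.exp (-x / ε)
  bound_E₂ : ∀ j ≤ r, ∀ x ∈ unitI,
    |derivI j E₂ x| ≤ C₀ * ε ^ (1 - (j : ℤ)) * Real.exp (-(1 - x) / ε)

/-- The transition parameter `τ = ε^{1 - 1/(2k)}`. -/
def transitionPoint (k : ℕ) (ε : ℝ) : ℝ := ε ^ (1 - 1 / (2 * (k : ℝ)))

/-- The mesh points `x_0, …, x_{2n+m}`: `n` cells of length `h` in `[0,τ]`, `m` cells of length
`H` in `[τ,1-τ]` and `n` cells of length `h` in `[1-τ,1]`. -/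
def meshPoint (τ H h : ℝ) (n m i : ℕ) : ℝ :=
  if i ≤ n then (i : ℝ) * h
  else if i ≤ n + m then τ + ((i : ℝ) - n) * H
  else 1 - τ + ((i : ℝ) - n - m) * h

/-- The parameters describe a mesh of `[0,1]` which is equidistant with mesh size
`h = α H ε^{1-1/(2k)}` in `[0,τ]` and in `[1-τ,1]` and equidistant with mesh size `H` in between. -/
structure IsLayerMesh (k : ℕ) (ε α H h : ℝ) (n m : ℕ) : Prop where
  H_pos : 0 < H
  m_pos : 0 < m
  fine_size : h = α * H * ε ^ (1 - 1 / (2 * (k : ℝ)))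
  fine_cells : n * h = transitionPoint k ε
  coarse_cells : m * H = 1 - 2 * transitionPoint k ε

/-- Continuous piecewise polynomials of degree at most `k` with respect to the mesh points
`x 0, …, x N` (continuity is forced, as the cells are closed and neighbours share a point). -/
def IsFE (k N : ℕ) (x : ℕ → ℝ) (v : ℝ → ℝ) : Prop :=
  ∀ i < N, ∃ p : Polynomial ℝ, p.natDegree ≤ k ∧
    ∀ t ∈ Set.Icc (x i) (x (i + 1)), v t = p.eval t

/-- The mixed finite element solution. The derivatives exist off the finitely many mesh points.
The terms with `b` and `deriv b` are `(u', (b ψ)')`, the weak form of `-b u''`. -/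
structure IsMixedFESolution (k N : ℕ) (x : ℕ → ℝ) (ε : ℝ) (b d f uH wH : ℝ → ℝ) : Prop where
  mem_u : IsFE k N x uH
  mem_w : IsFE k N x wH
  left_value : uH 0 = 0
  right_value : uH 1 = 0
  first : ∀ φ : ℝ → ℝ, IsFE k N x φ →
    ε * (∫ t in (0 : ℝ)..1, deriv uH t * deriv φ t) + (∫ t in (0 : ℝ)..1, wH t * φ t) = 0
  second : ∀ ψ : ℝ → ℝ, IsFE k N x ψ → ψ 0 = 0 → ψ 1 = 0 →
    (∫ t in (0 : ℝ)..1, b t * deriv uH t * deriv ψ t)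
      + (∫ t in (0 : ℝ)..1, deriv b t * deriv uH t * ψ t)
      + (∫ t in (0 : ℝ)..1, d t * uH t * ψ t)
      - ε * (∫ t in (0 : ℝ)..1, deriv wH t * deriv ψ t)
    = ∫ t in (0 : ℝ)..1, f t * ψ t

/-- `p = π v` is the interpolant of `v` of degree `k` that agrees with `v` in the mesh points and
preserves on each cell the `k - 1` moments with weights `(t - x_i)^l`, `s ≤ l ≤ s + k - 2`. -/
structure IsMomentInterpolant (k s N : ℕ) (x : ℕ → ℝ) (v p : ℝ → ℝ) : Prop where
  mem : IsFE k N x p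
  nodes : ∀ i ≤ N, p (x i) = v (x i)
  moments : ∀ i < N, ∀ l : ℕ, s ≤ l → l + 1 < s + k →
    (∫ t in (x i)..(x (i + 1)), (t - x i) ^ l * p t)
      = ∫ t in (x i)..(x (i + 1)), (t - x i) ^ l * v t

/-- The norm `‖(v,w)‖₁ = (|v|₁² + ‖w‖₀²)^{1/2}` on `(0,1)`. -/
def pairNorm (v w : ℝ → ℝ) : ℝ :=
  Real.sqrt ((∫ t in (0 : ℝ)..1, deriv v t ^ 2) + ∫ t in (0 : ℝ)..1, w t ^ 2)

end

/-! Tested with the pair $(u,w)$ itself, the mixed form loses both $\varepsilon$-terms, since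
$\varepsilon(u',w')$ occurs once with each sign. Integrating $(b'u',u)$ by parts leaves
$(bu',u')+((d-\tfrac12 b'')u,u)+\|w\|^2$, so the form is coercive uniformly in $\varepsilon$
(`mixed_coercive`). In finite dimensions this gives unique solvability.

For the error, put $\xi=\pi u-u_H$, $\eta=\pi w-w_H$ with the interpolant for $s=0$. The exact pair
satisfies the same equations, so the form at $(\xi,\eta)$ equals the form at the interpolation
errors $(e,g)$, tested with $(\xi,\eta)$. The dangerous terms $\varepsilon(e',\eta')$ and
$\varepsilon(g',\xi')$ vanish: $e,g$ are zero at the mesh points and orthogonal on each cell to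
polynomials of degree at most $k-2$ (`IsMomentInterpolant.integral_deriv_mul_deriv`). Young's
inequality then bounds $\xi',\eta$ by $e,e',g$ in $L_2$ (`exists_supercloseness`). The case $s=1$
lacks this orthogonality and follows from the estimate of $u-u_H$, $w-w_H$ by the triangle
inequality.

It remains to bound $e,e',g$. Unisolvence on a reference cell and Taylor approximation give
$\ell^{2k}\int v^2$ on a cell of length $\ell$, with $v=u^{(k+1)}$ or $v=\varepsilon u^{(k+2)}$.
Both are at most a constant times $1+\varepsilon^{-k}(e^{-x/\varepsilon}+e^{-(1-x)/\varepsilon})$.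
On fine cells $\varepsilon\tau^{2k}=\varepsilon^{2k}$ turns $h^{2k}\varepsilon^{-2k}$ into
$H^{2k}\varepsilon^{-1}$ up to a constant, and $\varepsilon^{-1}e^{-2x/\varepsilon}$ has bounded
integral. On coarse cells $e^{-\tau/\varepsilon}$ beats $\varepsilon^{-k}$ (`IsLayerMesh.weight_le`,
`exists_layer_interpolation_error`). -/

/-! ### Partitions of the unit interval -/

/-- The points `x 0 < x 1 < … < x N` form a partition of `[0,1]`. -/
structure IsPartition (N : ℕ) (x : ℕ → ℝ) : Prop where
  left : x 0 = 0
  right : x N = 1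
  lt_succ : ∀ i < N, x i < x (i + 1)

/-- `g` agrees on the interior of each cell with a function continuous on the closed cell. -/
def PiecewiseCont (N : ℕ) (x : ℕ → ℝ) (g : ℝ → ℝ) : Prop :=
  ∀ i < N, ∃ G : ℝ → ℝ, ContinuousOn G (Icc (x i) (x (i + 1))) ∧
    EqOn g G (Ioo (x i) (x (i + 1)))

/-- `v` is continuously differentiable on each closed cell. -/
def PiecewiseC1 (N : ℕ) (x : ℕ → ℝ) (v : ℝ → ℝ) : Prop :=
  ∀ i < N, ContDiffOn ℝ 1 v (Icc (x i) (x (i + 1)))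

/-- The union of the open cells. -/
def cellInteriors (N : ℕ) (x : ℕ → ℝ) : Set ℝ := {t | ∃ i < N, t ∈ Ioo (x i) (x (i + 1))}

namespace IsPartition

variable {N : ℕ} {x : ℕ → ℝ}

theorem le_of_le (hx : IsPartition N x) {i j : ℕ} (hij : i ≤ j) (hj : j ≤ N) : x i ≤ x j := by
  induction j, hij using Nat.le_induction with
  | base => exact le_rfl
  | succ j _ ih => exact (ih (by omega)).trans (hx.lt_succ j (by omega)).le

theorem nonneg (hx : IsPartition N x) {i : ℕ} (hi : i ≤ N) : 0 ≤ x i :=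
  hx.left ▸ hx.le_of_le (Nat.zero_le i) hi

theorem le_one (hx : IsPartition N x) {i : ℕ} (hi : i ≤ N) : x i ≤ 1 :=
  hx.right ▸ hx.le_of_le hi le_rfl

theorem cell_subset (hx : IsPartition N x) {i : ℕ} (hi : i < N) :
    Icc (x i) (x (i + 1)) ⊆ unitI :=
  Icc_subset_Icc (hx.nonneg hi.le) (hx.le_one hi)

theorem open_cell_subset (hx : IsPartition N x) {i : ℕ} (hi : i < N) :
    Ioo (x i) (x (i + 1)) ⊆ Ioo 0 1 :=
  Ioo_subset_Ioo (hx.nonneg hi.le) (hx.le_one hi)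

theorem cellInteriors_subset (hx : IsPartition N x) : cellInteriors N x ⊆ Ioo 0 1 := by
  rintro t ⟨i, hi, ht⟩
  exact hx.open_cell_subset hi ht

theorem exists_cell (hx : IsPartition N x) {t : ℝ} (ht : t ∈ unitI) :
    ∃ i < N, t ∈ Icc (x i) (x (i + 1)) := by
  have hN : 0 < N := by
    rcases Nat.eq_zero_or_pos N with h | h
    · have h1 := hx.right
      rw [h, hx.left] at h1
      norm_num at h1
    · exact h
  by_contra! hcon
  have key : ∀ i ≤ N, x i ≤ t := by
    intro i
    induction i with
    | zero => intro _; rw [hx.left]; exact ht.1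
    | succ i ih =>
      intro hi
      by_contra! hlt
      exact hcon i (by omega) ⟨ih (by omega), hlt.le⟩
  have h1 := hcon (N - 1) (by omega)
  apply h1
  refine ⟨key _ (by omega), ?_⟩
  rw [Nat.sub_add_cancel hN, hx.right]
  exact ht.2

end IsPartition

/-! ### Integration and differentiation of piecewise smooth functions -/

section calculus

variable {N : ℕ} {x : ℕ → ℝ}

theorem PiecewiseCont.congr {f g : ℝ → ℝ} (hf : PiecewiseCont N x f)
    (h : EqOn g f (cellInteriors N x)) : PiecewiseCont N x g := by
  intro i hi
  obtain ⟨F, hF, hfF⟩ := hf i hi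
  exact ⟨F, hF, fun t ht => (h ⟨i, hi, ht⟩).trans (hfF ht)⟩

theorem PiecewiseCont.add {f g : ℝ → ℝ} (hf : PiecewiseCont N x f) (hg : PiecewiseCont N x g) :
    PiecewiseCont N x (fun t => f t + g t) := by
  intro i hi
  obtain ⟨F, hF, hfF⟩ := hf i hi
  obtain ⟨G, hG, hgG⟩ := hg i hi
  exact ⟨fun t => F t + G t, hF.add hG, fun t ht => by simp only [hfF ht, hgG ht]⟩

theorem PiecewiseCont.sub {f g : ℝ → ℝ} (hf : PiecewiseCont N x f) (hg : PiecewiseCont N x g) :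
    PiecewiseCont N x (fun t => f t - g t) := by
  intro i hi
  obtain ⟨F, hF, hfF⟩ := hf i hi
  obtain ⟨G, hG, hgG⟩ := hg i hi
  exact ⟨fun t => F t - G t, hF.sub hG, fun t ht => by simp only [hfF ht, hgG ht]⟩

theorem PiecewiseCont.mul {f g : ℝ → ℝ} (hf : PiecewiseCont N x f) (hg : PiecewiseCont N x g) :
    PiecewiseCont N x (fun t => f t * g t) := by
  intro i hi
  obtain ⟨F, hF, hfF⟩ := hf i hi
  obtain ⟨G, hG, hgG⟩ := hg i hi
  exact ⟨fun t => F t * G t, hF.mul hG, fun t ht => by simp only [hfF ht, hgG ht]⟩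

theorem PiecewiseCont.const (c : ℝ) : PiecewiseCont N x (fun _ => c) :=
  fun _ _ => ⟨fun _ => c, continuousOn_const, fun _ _ => rfl⟩

theorem PiecewiseCont.sq {f : ℝ → ℝ} (hf : PiecewiseCont N x f) :
    PiecewiseCont N x (fun t => f t ^ 2) := by
  simpa only [pow_two] using hf.mul hf

theorem ContinuousOn.piecewiseCont (hx : IsPartition N x) {f : ℝ → ℝ}
    (hf : ContinuousOn f unitI) : PiecewiseCont N x f :=
  fun _ hi => ⟨f, hf.mono (hx.cell_subset hi), fun _ _ => rfl⟩

theorem PiecewiseC1.piecewiseCont {v : ℝ → ℝ} (hv : PiecewiseC1 N x v) : PiecewiseCont N x v :=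
  fun i hi => ⟨v, (hv i hi).continuousOn, fun _ _ => rfl⟩

theorem ContDiffOn.piecewiseC1 (hx : IsPartition N x) {v : ℝ → ℝ}
    (hv : ContDiffOn ℝ 1 v unitI) : PiecewiseC1 N x v :=
  fun _ hi => hv.mono (hx.cell_subset hi)

theorem PiecewiseC1.add {f g : ℝ → ℝ} (hf : PiecewiseC1 N x f) (hg : PiecewiseC1 N x g) :
    PiecewiseC1 N x (fun t => f t + g t) := fun i hi => (hf i hi).add (hg i hi)

theorem PiecewiseC1.sub {f g : ℝ → ℝ} (hf : PiecewiseC1 N x f) (hg : PiecewiseC1 N x g) :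
    PiecewiseC1 N x (fun t => f t - g t) := fun i hi => (hf i hi).sub (hg i hi)

theorem PiecewiseC1.mul {f g : ℝ → ℝ} (hf : PiecewiseC1 N x f) (hg : PiecewiseC1 N x g) :
    PiecewiseC1 N x (fun t => f t * g t) := fun i hi => (hf i hi).mul (hg i hi)

theorem PiecewiseC1.const_mul {f : ℝ → ℝ} (c : ℝ) (hf : PiecewiseC1 N x f) :
    PiecewiseC1 N x (fun t => c * f t) := fun i hi => contDiffOn_const.mul (hf i hi)

theorem PiecewiseC1.differentiableAt {v : ℝ → ℝ} (hv : PiecewiseC1 N x v) {t : ℝ}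
    (ht : t ∈ cellInteriors N x) : DifferentiableAt ℝ v t := by
  obtain ⟨i, hi, hti⟩ := ht
  exact ((hv i hi).differentiableOn (by norm_num)).differentiableAt (Icc_mem_nhds hti.1 hti.2)

theorem PiecewiseC1.deriv {v : ℝ → ℝ} (hx : IsPartition N x) (hv : PiecewiseC1 N x v) :
    PiecewiseCont N x (deriv v) := by
  intro i hi
  refine ⟨derivWithin v (Icc (x i) (x (i + 1))),
    (hv i hi).continuousOn_derivWithin (uniqueDiffOn_Icc (hx.lt_succ i hi)) le_rfl, ?_⟩
  intro t ht
  exact (derivWithin_of_mem_nhds (Icc_mem_nhds ht.1 ht.2)).symm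

theorem PiecewiseCont.intervalIntegrable_cell (hx : IsPartition N x) {g : ℝ → ℝ}
    (hg : PiecewiseCont N x g) {i : ℕ} (hi : i < N) :
    IntervalIntegrable g MeasureTheory.volume (x i) (x (i + 1)) := by
  obtain ⟨G, hG, hgG⟩ := hg i hi
  have hle := (hx.lt_succ i hi).le
  have h1 : IntervalIntegrable G MeasureTheory.volume (x i) (x (i + 1)) :=
    ContinuousOn.intervalIntegrable (by rwa [uIcc_of_le hle])
  exact h1.congr_uIoo (by rw [uIoo_of_le hle]; exact hgG.symm)

theorem PiecewiseCont.intervalIntegrable (hx : IsPartition N x) {g : ℝ → ℝ}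
    (hg : PiecewiseCont N x g) : IntervalIntegrable g MeasureTheory.volume 0 1 := by
  have h := IntervalIntegrable.trans_iterate (a := x) (n := N)
    (fun i hi => hg.intervalIntegrable_cell hx hi)
  rwa [hx.left, hx.right] at h

theorem PiecewiseCont.integral_eq_sum (hx : IsPartition N x) {g : ℝ → ℝ}
    (hg : PiecewiseCont N x g) :
    ∫ t in (0 : ℝ)..1, g t = ∑ i ∈ Finset.range N, ∫ t in (x i)..(x (i + 1)), g t := by
  rw [intervalIntegral.sum_integral_adjacent_intervals (a := x) (n := N)
    (fun i hi => hg.intervalIntegrable_cell hx hi), hx.left, hx.right]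

/-- The mesh points form a null set. Every identity involving `deriv` of a broken function is used
through this lemma, because at a mesh point `deriv` may carry no information. -/
theorem PiecewiseCont.integral_congr (hx : IsPartition N x) {f g : ℝ → ℝ}
    (hg : PiecewiseCont N x g) (h : EqOn f g (cellInteriors N x)) :
    ∫ t in (0 : ℝ)..1, f t = ∫ t in (0 : ℝ)..1, g t := by
  rw [(hg.congr h).integral_eq_sum hx, hg.integral_eq_sum hx]
  refine Finset.sum_congr rfl fun i hi => ?_
  rw [Finset.mem_range] at hi
  exact intervalIntegral.integral_congr_Ioo_of_le (hx.lt_succ i hi).le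
    (fun t ht => h ⟨i, hi, ht⟩)

theorem PiecewiseCont.integral_mono (hx : IsPartition N x) {f g : ℝ → ℝ}
    (hf : PiecewiseCont N x f) (hg : PiecewiseCont N x g)
    (h : ∀ t ∈ cellInteriors N x, f t ≤ g t) :
    ∫ t in (0 : ℝ)..1, f t ≤ ∫ t in (0 : ℝ)..1, g t := by
  rw [hf.integral_eq_sum hx, hg.integral_eq_sum hx]
  refine Finset.sum_le_sum fun i hi => ?_
  rw [Finset.mem_range] at hi
  exact intervalIntegral.integral_mono_on_of_le_Ioo (hx.lt_succ i hi).le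
    (hf.intervalIntegrable_cell hx hi) (hg.intervalIntegrable_cell hx hi)
    (fun t ht => h t ⟨i, hi, ht⟩)

theorem PiecewiseC1.integral_deriv_cell (hx : IsPartition N x) {v : ℝ → ℝ}
    (hv : PiecewiseC1 N x v) {i : ℕ} (hi : i < N) :
    ∫ t in (x i)..(x (i + 1)), _root_.deriv v t = v (x (i + 1)) - v (x i) :=
  intervalIntegral.integral_eq_sub_of_hasDerivAt_of_le (hx.lt_succ i hi).le
    (hv i hi).continuousOn (fun _ ht => (hv.differentiableAt ⟨i, hi, ht⟩).hasDerivAt)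
    ((hv.deriv hx).intervalIntegrable_cell hx hi)

/-- The cell contributions telescope without jump terms: neighbouring closed cells share a point, so
piecewise smoothness on closed cells includes continuity. -/
theorem PiecewiseC1.integral_deriv (hx : IsPartition N x) {v : ℝ → ℝ}
    (hv : PiecewiseC1 N x v) : ∫ t in (0 : ℝ)..1, _root_.deriv v t = v 1 - v 0 := by
  rw [(hv.deriv hx).integral_eq_sum hx, ← hx.left, ← hx.right,
    ← Finset.sum_range_sub (fun i => v (x i)) N]
  refine Finset.sum_congr rfl fun i hi => ?_
  exact hv.integral_deriv_cell hx (Finset.mem_range.1 hi)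

theorem PiecewiseC1.deriv_mul {u v : ℝ → ℝ} (hu : PiecewiseC1 N x u) (hv : PiecewiseC1 N x v) :
    EqOn (_root_.deriv (fun t => u t * v t))
      (fun t => _root_.deriv u t * v t + u t * _root_.deriv v t) (cellInteriors N x) :=
  fun _ ht => ((hu.differentiableAt ht).hasDerivAt.mul (hv.differentiableAt ht).hasDerivAt).deriv

theorem PiecewiseC1.deriv_sub {u v : ℝ → ℝ} (hu : PiecewiseC1 N x u) (hv : PiecewiseC1 N x v) :
    EqOn (_root_.deriv (fun t => u t - v t))
      (fun t => _root_.deriv u t - _root_.deriv v t) (cellInteriors N x) :=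
  fun _ ht => ((hu.differentiableAt ht).hasDerivAt.sub (hv.differentiableAt ht).hasDerivAt).deriv

theorem PiecewiseC1.deriv_add {u v : ℝ → ℝ} (hu : PiecewiseC1 N x u) (hv : PiecewiseC1 N x v) :
    EqOn (_root_.deriv (fun t => u t + v t))
      (fun t => _root_.deriv u t + _root_.deriv v t) (cellInteriors N x) :=
  fun _ ht => ((hu.differentiableAt ht).hasDerivAt.add (hv.differentiableAt ht).hasDerivAt).deriv

/-- Integration by parts for piecewise continuously differentiable functions. -/
theorem PiecewiseC1.integral_by_parts (hx : IsPartition N x) {u v : ℝ → ℝ}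
    (hu : PiecewiseC1 N x u) (hv : PiecewiseC1 N x v) :
    ∫ t in (0 : ℝ)..1, (_root_.deriv u t * v t + u t * _root_.deriv v t)
      = u 1 * v 1 - u 0 * v 0 := by
  have h := (hu.mul hv).integral_deriv hx
  rw [← h]
  exact (((hu.mul hv).deriv hx).integral_congr hx fun t ht => (hu.deriv_mul hv ht).symm)

/-- A nonzero value, even at a mesh point, makes the integral over a closed cell containing it
positive, by continuity on that cell. -/
theorem PiecewiseC1.eq_zero_of_integral_sq (hx : IsPartition N x) {v : ℝ → ℝ}
    (hv : PiecewiseC1 N x v) (h : ∫ t in (0 : ℝ)..1, v t ^ 2 ≤ 0) : ∀ t ∈ unitI, v t = 0 := by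
  intro t ht
  obtain ⟨i, hi, hti⟩ := hx.exists_cell ht
  by_contra hne
  rw [hv.piecewiseCont.sq.integral_eq_sum hx] at h
  have hnn : ∀ j ∈ Finset.range N, 0 ≤ ∫ t in (x j)..(x (j + 1)), v t ^ 2 := fun j hj =>
    intervalIntegral.integral_nonneg (hx.lt_succ j (Finset.mem_range.1 hj)).le
      (fun _ _ => sq_nonneg _)
  have hpos : 0 < ∫ t in (x i)..(x (i + 1)), v t ^ 2 :=
    intervalIntegral.integral_pos (hx.lt_succ i hi) ((hv i hi).continuousOn.pow 2)
      (fun _ _ => sq_nonneg _) ⟨t, hti, by positivity⟩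
  have := Finset.single_le_sum hnn (Finset.mem_range.2 hi)
  linarith

end calculus

/-! ### Iterated derivatives on the closed interval -/

section derivI

theorem uniqueDiffOn_unitI : UniqueDiffOn ℝ unitI := uniqueDiffOn_Icc zero_lt_one

theorem continuousOn_derivI {r : ℕ} {v : ℝ → ℝ} (hv : ContDiffOn ℝ r v unitI) {j : ℕ}
    (hj : j ≤ r) : ContinuousOn (derivI j v) unitI :=
  hv.continuousOn_iteratedDerivWithin (by exact_mod_cast hj) uniqueDiffOn_unitI

theorem hasDerivAt_derivI {r : ℕ} {v : ℝ → ℝ} (hv : ContDiffOn ℝ r v unitI) {j : ℕ}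
    (hj : j < r) {t : ℝ} (ht : t ∈ Ioo (0 : ℝ) 1) :
    HasDerivAt (derivI j v) (derivI (j + 1) v t) t := by
  have h := hv.differentiableOn_iteratedDerivWithin (m := j) (by exact_mod_cast hj)
    uniqueDiffOn_unitI
  have h1 := (h t (Ioo_subset_Icc_self ht)).hasDerivWithinAt
  have h2 := h1.hasDerivAt (Icc_mem_nhds ht.1 ht.2)
  simpa only [derivI, iteratedDerivWithin_succ] using h2

theorem derivI_zero (v : ℝ → ℝ) : derivI 0 v = v := by
  funext t
  simp [derivI]

theorem contDiffOn_derivI {r : ℕ} {v : ℝ → ℝ} (hv : ContDiffOn ℝ r v unitI) {j : ℕ}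
    (hj : j < r) : ContDiffOn ℝ 1 (derivI j v) unitI := by
  have h0 : (1 : WithTop ℕ∞) = 0 + 1 := by norm_num
  rw [h0, contDiffOn_succ_iff_derivWithin uniqueDiffOn_unitI]
  refine ⟨hv.differentiableOn_iteratedDerivWithin (m := j) (by exact_mod_cast hj)
    uniqueDiffOn_unitI, by simp, ?_⟩
  rw [contDiffOn_zero]
  have h := continuousOn_derivI hv (j := j + 1) hj
  have e : derivI (j + 1) v = derivWithin (derivI j v) unitI := iteratedDerivWithin_succ
  rwa [e] at h

end derivI

/-! ### Unisolvence and stability of the degrees of freedom on a reference cell -/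

section reference
open Polynomial

/-- The moment `∫₀¹ yˡ p(y) dy` as a linear functional of the polynomial `p`. -/
noncomputable def unitMoment (l : ℕ) : ℝ[X] →ₗ[ℝ] ℝ where
  toFun p := ∫ y in (0 : ℝ)..1, y ^ l * p.eval y
  map_add' p q := by
    simp only [eval_add, mul_add]
    exact intervalIntegral.integral_add (by apply Continuous.intervalIntegrable; fun_prop)
      (by apply Continuous.intervalIntegrable; fun_prop)
  map_smul' c p := by
    simp only [eval_smul, smul_eq_mul, RingHom.id_apply]
    rw [← intervalIntegral.integral_const_mul]
    congr 1
    funext y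
    ring

theorem unitMoment_apply (l : ℕ) (p : ℝ[X]) :
    unitMoment l p = ∫ y in (0 : ℝ)..1, y ^ l * p.eval y := rfl

theorem unitMoment_mul_X_pow (l j : ℕ) (p : ℝ[X]) :
    unitMoment l (X ^ j * p) = unitMoment (l + j) p := by
  simp only [unitMoment_apply, eval_mul, eval_pow, eval_X]
  congr 1
  funext y
  ring

/-- The degrees of freedom of the moment interpolation on `[0,1]`. -/
noncomputable def unitDofs (k s : ℕ) : ℝ[X] →ₗ[ℝ] ℝ × ℝ × (Fin (k - 1) → ℝ) :=
  (leval 0).prod ((leval 1).prod (LinearMap.pi fun l => unitMoment (s + l)))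

theorem unitDofs_apply (k s : ℕ) (p : ℝ[X]) :
    unitDofs k s p = (p.eval 0, p.eval 1, fun l : Fin (k - 1) => unitMoment (s + l) p) := rfl

/-- The end point values give $p=y(y-1)q$, and $q\ne0$ would have degree at most $k-2$. The
vanishing moments then yield $\int y^s qp=0$, while $y^s qp=-y^{s+1}(1-y)q^2$ has one sign on
$[0,1]$. Hence $q=0$, for every $s$. -/
theorem eq_zero_of_unitDofs_eq_zero {k s : ℕ} {p : ℝ[X]} (hp : p.natDegree ≤ k)
    (h : unitDofs k s p = 0) : p = 0 := by
  rw [unitDofs_apply, Prod.mk_eq_zero, Prod.mk_eq_zero] at h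
  obtain ⟨h0, h1, hm⟩ := h
  have hm' : ∀ l < k - 1, unitMoment (s + l) p = 0 := fun l hl => congrFun hm ⟨l, hl⟩
  obtain ⟨q, hq⟩ : (X - C 0) * (X - C 1) ∣ p := by
    refine IsCoprime.mul_dvd ?_ (dvd_iff_isRoot.2 h0) (dvd_iff_isRoot.2 h1)
    exact isCoprime_X_sub_C_of_isUnit_sub (by norm_num)
  by_contra hne
  have hq0 : q ≠ 0 := by
    rintro rfl
    exact hne (by rw [hq, mul_zero])
  have hdeg : q.natDegree < k - 1 := by
    have h2 : p.natDegree = 2 + q.natDegree := by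
      rw [hq, natDegree_mul (mul_ne_zero (X_sub_C_ne_zero _) (X_sub_C_ne_zero _)) hq0,
        natDegree_mul (X_sub_C_ne_zero _) (X_sub_C_ne_zero _), natDegree_X_sub_C,
        natDegree_X_sub_C]
    omega
  -- Each monomial $y^l$ of $q$ shifts the moment to $s+l$, which lies among the prescribed ones.
  have hint : unitMoment s (q * p) = 0 := by
    conv_lhs => rw [q.as_sum_range]
    rw [Finset.sum_mul, map_sum]
    refine Finset.sum_eq_zero fun l hl => ?_
    rw [Finset.mem_range] at hl
    rw [← C_mul_X_pow_eq_monomial, mul_assoc, ← smul_eq_C_mul, map_smul, unitMoment_mul_X_pow,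
      hm' l (by omega), smul_zero]
  have hroots : ∀ y ∈ Ioo (0 : ℝ) 1, q.IsRoot y := by
    intro y hy
    by_contra hy0
    have hpos : 0 < ∫ y in (0 : ℝ)..1, y ^ (s + 1) * (1 - y) * q.eval y ^ 2 := by
      refine intervalIntegral.integral_pos zero_lt_one (by fun_prop) ?_
        ⟨y, Ioo_subset_Icc_self hy, ?_⟩
      · intro t ht
        have h3 : 0 ≤ 1 - t := by linarith [ht.2]
        have h4 : 0 ≤ t := ht.1.le
        positivity
      · have h3 : 0 < 1 - y := by linarith [hy.2]
        have h4 : 0 < y := hy.1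
        have h5 : q.eval y ≠ 0 := hy0
        positivity
    have hneg : unitMoment s (q * p)
        = -∫ y in (0 : ℝ)..1, y ^ (s + 1) * (1 - y) * q.eval y ^ 2 := by
      rw [unitMoment_apply, ← intervalIntegral.integral_neg]
      congr 1
      funext t
      rw [hq]
      simp only [eval_mul, eval_sub, eval_X, eval_C]
      ring
    linarith
  exact hq0 (eq_zero_of_infinite_isRoot q ((Ioo_infinite zero_lt_one).mono hroots))

/-- The degrees of freedom as a linear map on polynomials of degree less than `k + 1`. -/
noncomputable def unitDofsCoeff (k s : ℕ) :
    (Fin (k + 1) → ℝ) →ₗ[ℝ] ℝ × ℝ × (Fin (k - 1) → ℝ) :=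
  (unitDofs k s).comp
    ((degreeLT ℝ (k + 1)).subtype.comp (degreeLTEquiv ℝ (k + 1)).symm.toLinearMap)

theorem natDegree_le_of_mem_degreeLT {k : ℕ} {p : ℝ[X]} (hp : p ∈ degreeLT ℝ (k + 1)) :
    p.natDegree ≤ k := by
  rw [mem_degreeLT] at hp
  exact natDegree_le_of_degree_le (Order.le_of_lt_succ (by exact_mod_cast hp))

theorem mem_degreeLT_of_natDegree_le {k : ℕ} {p : ℝ[X]} (hp : p.natDegree ≤ k) :
    p ∈ degreeLT ℝ (k + 1) := by
  rw [mem_degreeLT]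
  exact (degree_le_of_natDegree_le hp).trans_lt (by exact_mod_cast Nat.lt_succ_self k)

theorem unitDofsCoeff_injective (k s : ℕ) : Function.Injective (unitDofsCoeff k s) := by
  rw [injective_iff_map_eq_zero]
  intro c hc
  have h := eq_zero_of_unitDofs_eq_zero
    (natDegree_le_of_mem_degreeLT ((degreeLTEquiv ℝ (k + 1)).symm c).2) hc
  exact (LinearEquiv.map_eq_zero_iff _).1 (Subtype.ext h)

/-- Unisolvence is injectivity between spaces of equal dimension $k+1=2+(k-1)$. For $k=0$ the
truncated subtraction would leave two functionals on a line, hence `hk`. -/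
theorem exists_unitDofs_eq {k : ℕ} (hk : 1 ≤ k) (s : ℕ) (a : ℝ × ℝ × (Fin (k - 1) → ℝ)) :
    ∃ p : ℝ[X], p.natDegree ≤ k ∧ unitDofs k s p = a := by
  have hfin : Module.finrank ℝ (Fin (k + 1) → ℝ)
      = Module.finrank ℝ (ℝ × ℝ × (Fin (k - 1) → ℝ)) := by
    simp
    omega
  obtain ⟨c, hc⟩ := (LinearMap.injective_iff_surjective_of_finrank_eq_finrank hfin).1
    (unitDofsCoeff_injective k s) a
  exact ⟨_, natDegree_le_of_mem_degreeLT ((degreeLTEquiv ℝ (k + 1)).symm c).2, hc⟩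

/-- A polynomial of degree at most `k` and its derivative are bounded on `[0,1]` by the
degrees of freedom. -/
theorem exists_unit_stability (k s : ℕ) : ∃ K : ℝ, 0 < K ∧ ∀ (p : ℝ[X]) (B : ℝ),
    p.natDegree ≤ k → |p.eval 0| ≤ B → |p.eval 1| ≤ B →
    (∀ l < k - 1, |unitMoment (s + l) p| ≤ B) →
    ∀ y ∈ unitI, |p.eval y| ≤ K * B ∧ |p.derivative.eval y| ≤ K * B := by
  -- An injective linear map on a finite-dimensional space is bounded below, so the coefficients of
  -- $p$ are at most $AB$.
  obtain ⟨A, hA, hanti⟩ := LinearMap.exists_antilipschitzWith (unitDofsCoeff k s)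
    (LinearMap.ker_eq_bot.2 (unitDofsCoeff_injective k s))
  -- One factor $k+1$ counts the coefficients, the other bounds the factor that differentiation puts
  -- on each.
  refine ⟨(k + 1) ^ 2 * A, by positivity, ?_⟩
  intro p B hp h0 h1 hm y hy
  have hB : 0 ≤ B := (abs_nonneg _).trans h0
  set c := degreeLTEquiv ℝ (k + 1) ⟨p, mem_degreeLT_of_natDegree_le hp⟩ with hc
  have hcoeff : ∀ i : Fin (k + 1), c i = p.coeff i := fun i => rfl
  have hval : unitDofsCoeff k s c = unitDofs k s p := by
    simp [unitDofsCoeff, hc]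
  have hnorm : ‖c‖ ≤ A * B := by
    have h := hanti.le_mul_dist c 0
    rw [map_zero, dist_zero_right, dist_zero_right, hval, unitDofs_apply] at h
    refine h.trans (mul_le_mul_of_nonneg_left ?_ A.2)
    rw [norm_prod_le_iff, norm_prod_le_iff]
    exact ⟨h0, h1, (pi_norm_le_iff_of_nonneg hB).2 fun l => hm l l.2⟩
  have hci : ∀ i ≤ k, |p.coeff i| ≤ A * B := fun i hi =>
    (norm_le_pi_norm c ⟨i, Nat.lt_succ_of_le hi⟩).trans hnorm
  have hAB : 0 ≤ (A : ℝ) * B := by positivity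
  have hpow : ∀ i : ℕ, |y ^ i| ≤ 1 := fun i => by
    rw [abs_pow]
    exact pow_le_one₀ (abs_nonneg _) (abs_le.2 ⟨by linarith [hy.1], hy.2⟩)
  have hk0 : (0 : ℝ) ≤ k := Nat.cast_nonneg k
  constructor
  · rw [eval_eq_sum_range' (Nat.lt_succ_of_le hp)]
    refine (Finset.abs_sum_le_sum_abs _ _).trans ?_
    have hterm : ∀ i ∈ Finset.range (k + 1), |p.coeff i * y ^ i| ≤ A * B := by
      intro i hi
      rw [abs_mul]
      have := mul_le_mul (hci i (by simpa [Nat.lt_succ_iff] using hi)) (hpow i)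
        (abs_nonneg _) hAB
      linarith
    refine (Finset.sum_le_card_nsmul _ _ _ hterm).trans ?_
    rw [Finset.card_range, nsmul_eq_mul]
    push_cast
    nlinarith [mul_nonneg hk0 hAB, mul_nonneg hk0 (mul_nonneg hk0 hAB)]
  · have hd : p.derivative.natDegree < k + 1 :=
      (natDegree_derivative_le p).trans_lt (by omega)
    rw [eval_eq_sum_range' hd]
    refine (Finset.abs_sum_le_sum_abs _ _).trans ?_
    have hterm : ∀ i ∈ Finset.range (k + 1),
        |p.derivative.coeff i * y ^ i| ≤ (k + 1) * (A * B) := by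
      intro i hi
      rw [Finset.mem_range] at hi
      rw [abs_mul, coeff_derivative, abs_mul]
      have h2 : |(i : ℝ) + 1| ≤ k + 1 := by
        rw [abs_of_nonneg (by positivity)]
        have : (i : ℝ) ≤ k := by exact_mod_cast Nat.lt_succ_iff.1 hi
        linarith
      -- The sum runs up to $i=k$, so the index $i+1$ may exceed the degree.
      have h3 : |p.coeff (i + 1)| ≤ A * B := by
        rcases Nat.lt_or_ge k (i + 1) with h | h
        · rw [coeff_eq_zero_of_natDegree_lt (hp.trans_lt h), abs_zero]
          exact hAB
        · exact hci _ h
      have h4 := mul_le_mul h3 h2 (abs_nonneg _) hAB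
      have h5 := mul_le_mul h4 (hpow i) (abs_nonneg _) (by positivity)
      linarith
    refine (Finset.sum_le_card_nsmul _ _ _ hterm).trans ?_
    rw [Finset.card_range, nsmul_eq_mul]
    push_cast
    nlinarith

/-- The affine change of variables between a cell and `[0,1]`, for moments. -/
theorem integral_moment_scale (l : ℕ) (a h : ℝ) (p : ℝ[X]) :
    ∫ t in a..(a + h), (t - a) ^ l * p.eval t
      = h ^ (l + 1) * unitMoment l (p.comp (C h * X + C a)) := by
  have e := intervalIntegral.mul_integral_comp_mul_add (a := 0) (b := 1)
    (f := fun t => (t - a) ^ l * p.eval t) h a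
  rw [show h * 0 + a = a by ring, show h * 1 + a = a + h by ring] at e
  rw [← e, unitMoment_apply, pow_succ', mul_assoc]
  congr 1
  rw [← intervalIntegral.integral_const_mul]
  congr 1
  funext y
  simp only [eval_comp, eval_add, eval_mul, eval_C, eval_X]
  ring

theorem natDegree_comp_affine_le {k : ℕ} {p : ℝ[X]} (hp : p.natDegree ≤ k) (h a : ℝ) :
    (p.comp (C h * X + C a)).natDegree ≤ k := by
  refine natDegree_comp_le.trans ?_
  calc p.natDegree * (C h * X + C a).natDegree ≤ p.natDegree * 1 :=
        Nat.mul_le_mul_left _ natDegree_linear_le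
    _ ≤ k := by omega

/-- Stability of the degrees of freedom of the moment interpolation on a cell of length `h`. -/
theorem exists_cell_stability (k s : ℕ) : ∃ K : ℝ, 0 < K ∧ ∀ (a h : ℝ) (p : ℝ[X]) (B : ℝ),
    0 < h → p.natDegree ≤ k → |p.eval a| ≤ B → |p.eval (a + h)| ≤ B →
    (∀ l, s ≤ l → l + 1 < s + k →
      |∫ t in a..(a + h), (t - a) ^ l * p.eval t| ≤ h ^ (l + 1) * B) →
    ∀ t ∈ Icc a (a + h), |p.eval t| ≤ K * B ∧ |p.derivative.eval t| ≤ K * B / h := by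
  obtain ⟨K, hK, hstab⟩ := exists_unit_stability k s
  refine ⟨K, hK, ?_⟩
  intro a h p B hh hp h0 h1 hm t ht
  have hy : (t - a) / h ∈ unitI :=
    ⟨div_nonneg (by linarith [ht.1]) hh.le, (div_le_one hh).2 (by linarith [ht.2])⟩
  have key := hstab (p.comp (C h * X + C a)) B (natDegree_comp_affine_le hp h a)
    (by simpa using h0) (by simpa [add_comm] using h1)
    (fun l hl => by
      have h2 := hm (s + l) (by omega) (by omega)
      rw [integral_moment_scale, abs_mul, abs_of_pos (by positivity)] at h2
      exact le_of_mul_le_mul_left h2 (by positivity)) _ hy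
  have hback : h * ((t - a) / h) + a = t := by field_simp; ring
  simp only [eval_comp, eval_add, eval_mul, eval_C, eval_X, hback, derivative_comp,
    derivative_add, derivative_mul, derivative_C, derivative_X, zero_mul, mul_one, zero_add,
    add_zero] at key
  refine ⟨key.1, ?_⟩
  rw [le_div_iff₀ hh]
  have := key.2
  rw [abs_mul, abs_of_pos hh] at this
  linarith

/-- Existence of the moment interpolant on a single cell. -/
theorem exists_cell_interpolant {k : ℕ} (hk : 1 ≤ k) (s : ℕ) {a h : ℝ} (hh : 0 < h)
    (v : ℝ → ℝ) : ∃ p : ℝ[X], p.natDegree ≤ k ∧ p.eval a = v a ∧ p.eval (a + h) = v (a + h) ∧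
    ∀ l, s ≤ l → l + 1 < s + k →
      ∫ t in a..(a + h), (t - a) ^ l * p.eval t = ∫ t in a..(a + h), (t - a) ^ l * v t := by
  -- The prescribed moments on $[0,1]$ are those of $v$ divided by the factor $h^{l+1}$ of the
  -- affine change of variables.
  obtain ⟨q, hq, hdof⟩ := exists_unitDofs_eq hk s (v a, v (a + h), fun l : Fin (k - 1) =>
    (h ^ (s + (l : ℕ) + 1))⁻¹ * ∫ t in a..(a + h), (t - a) ^ (s + (l : ℕ)) * v t)
  rw [unitDofs_apply, Prod.mk.injEq, Prod.mk.injEq] at hdof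
  obtain ⟨h0, h1, hm⟩ := hdof
  have hcomp : (q.comp (C h⁻¹ * X + C (-(h⁻¹ * a)))).comp (C h * X + C a) = q := by
    rw [comp_assoc]
    have : (C h⁻¹ * X + C (-(h⁻¹ * a))).comp (C h * X + C a) = (X : ℝ[X]) := by
      simp only [add_comp, mul_comp, C_comp, X_comp]
      rw [mul_add, ← mul_assoc, ← C_mul, inv_mul_cancel₀ hh.ne', ← C_mul, add_assoc, ← C_add]
      simp
    rw [this, comp_X]
  refine ⟨q.comp (C h⁻¹ * X + C (-(h⁻¹ * a))), natDegree_comp_affine_le hq _ _, ?_, ?_, ?_⟩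
  · simp [h0]
  · rw [← h1]
    simp only [eval_comp, eval_add, eval_mul, eval_C, eval_X]
    congr 1
    field_simp
    ring
  · intro l hl hlk
    obtain ⟨j, rfl⟩ := Nat.exists_eq_add_of_le hl
    rw [integral_moment_scale, hcomp]
    have := congrFun hm ⟨j, by omega⟩
    simp only at this
    rw [this]
    field_simp

end reference

/-! ### Taylor approximation and local interpolation errors -/

section approximation
open Polynomial

theorem exists_polynomial_antideriv (p : ℝ[X]) :
    ∃ q : ℝ[X], q.derivative = p ∧ q.natDegree ≤ p.natDegree + 1 := by
  refine ⟨∑ i ∈ Finset.range (p.natDegree + 1), monomial (i + 1) (p.coeff i / (i + 1)), ?_, ?_⟩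
  · conv_rhs => rw [p.as_sum_range]
    rw [derivative_sum]
    refine Finset.sum_congr rfl fun i _ => ?_
    rw [derivative_monomial]
    simp only [Nat.add_sub_cancel]
    congr 1
    push_cast
    field_simp
  · refine natDegree_sum_le_of_forall_le _ _ fun i hi => ?_
    rw [Finset.mem_range] at hi
    exact (natDegree_monomial_le _).trans (by omega)

/-- Integrating a polynomial approximation of a derivative. -/
theorem exists_approx_of_deriv {a b B : ℝ} {f f' : ℝ → ℝ}
    (hf : ContinuousOn f (Icc a b)) (hf' : ∀ t ∈ Ioo a b, HasDerivAt f (f' t) t) {p : ℝ[X]}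
    (hp : ∀ t ∈ Icc a b, |f' t - p.eval t| ≤ B) :
    ∃ q : ℝ[X], q.derivative = p ∧ q.natDegree ≤ p.natDegree + 1 ∧
      ∀ t ∈ Icc a b, |f t - q.eval t| ≤ (b - a) * B := by
  obtain ⟨Q, hQ, hdeg⟩ := exists_polynomial_antideriv p
  refine ⟨Q + C (f a - Q.eval a), by simp [hQ], ?_, ?_⟩
  · rwa [natDegree_add_C]
  · intro t ht
    have hcont : ContinuousOn (fun y => f y - Q.eval y) (Icc a b) :=
      hf.sub Q.continuous.continuousOn
    have hder : ∀ y ∈ Ioo a b, HasDerivAt (fun y => f y - Q.eval y) (f' y - p.eval y) y :=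
      fun y hy => (hf' y hy).sub (hQ ▸ Q.hasDerivAt y)
    have hB : 0 ≤ B := (abs_nonneg _).trans (hp t ht)
    have hlip : |(f t - Q.eval t) - (f a - Q.eval a)| ≤ B * (t - a) := by
      rcases ht.1.eq_or_lt with h | h
      · rw [← h]
        simp
      · have hsub : Icc a t ⊆ Icc a b := Icc_subset_Icc_right ht.2
        obtain ⟨c, hc, hce⟩ := exists_hasDerivAt_eq_slope (fun y => f y - Q.eval y)
          (fun y => f' y - p.eval y) h (hcont.mono hsub)
          (fun y hy => hder y ⟨hy.1, hy.2.trans_le ht.2⟩)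
        have hne : t - a ≠ 0 := by linarith
        rw [eq_div_iff hne] at hce
        rw [← hce, abs_mul, abs_of_pos (by linarith : 0 < t - a)]
        exact mul_le_mul_of_nonneg_right (hp c ⟨hc.1.le, hc.2.le.trans ht.2⟩) (by linarith)
    have e : f t - (Q + C (f a - Q.eval a)).eval t = (f t - Q.eval t) - (f a - Q.eval a) := by
      simp only [eval_add, eval_C]
      ring
    rw [e]
    refine hlip.trans ?_
    rw [mul_comm]
    exact mul_le_mul_of_nonneg_right (by linarith [ht.2]) hB

/-- Taylor approximation with the remainder controlled by the `L₁` norm of the highest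
derivative. The functions `g 0, g 1, …` are the successive derivatives of `g 0`. -/
theorem exists_taylor_approx {a b : ℝ} (m : ℕ) :
    ∀ g : ℕ → ℝ → ℝ, (∀ j ≤ m + 1, ContinuousOn (g j) (Icc a b)) →
    (∀ j < m + 1, ∀ t ∈ Ioo a b, HasDerivAt (g j) (g (j + 1) t) t) →
    ∃ q : ℝ[X], q.natDegree ≤ m ∧
      ∀ t ∈ Icc a b, |g 0 t - q.eval t| ≤ (b - a) ^ m * ∫ y in a..b, |g (m + 1) y| := by
  induction m with
  | zero =>
    intro g hc hd
    refine ⟨C (g 0 a), by simp, ?_⟩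
    intro t ht
    have hab : a ≤ b := ht.1.trans ht.2
    have hint : IntervalIntegrable (g 1) MeasureTheory.volume a b :=
      ContinuousOn.intervalIntegrable (by rw [uIcc_of_le hab]; exact hc 1 le_rfl)
    have hsub : uIcc a t ⊆ uIcc a b := by
      rw [uIcc_of_le ht.1, uIcc_of_le hab]
      exact Icc_subset_Icc_right ht.2
    have ftc := intervalIntegral.integral_eq_sub_of_hasDerivAt_of_le ht.1
      ((hc 0 (by omega)).mono (Icc_subset_Icc_right ht.2))
      (fun y hy => hd 0 (by omega) y ⟨hy.1, hy.2.trans_le ht.2⟩) (hint.mono_set hsub)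
    rw [eval_C, ← ftc, pow_zero, one_mul]
    refine (intervalIntegral.abs_integral_le_integral_abs ht.1).trans ?_
    exact intervalIntegral.integral_mono_interval le_rfl ht.1 ht.2
      (Filter.Eventually.of_forall fun y => abs_nonneg _) hint.abs
  | succ m ih =>
    intro g hc hd
    -- Approximate the derivative and integrate the polynomial; each integration gains one factor
    -- $b-a$.
    obtain ⟨p, hp, hpb⟩ := ih (fun j => g (j + 1)) (fun j hj => hc (j + 1) (by omega))
      (fun j hj => hd (j + 1) (by omega))
    obtain ⟨q, -, hq, hqb⟩ := exists_approx_of_deriv (hc 0 (by omega)) (hd 0 (by omega)) hpb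
    refine ⟨q, by omega, fun t ht => (hqb t ht).trans_eq ?_⟩
    ring

/-- `p` is the moment interpolant of degree `k` of `v` on the cell `[a, a + h]`. -/
structure IsCellInterpolant (k s : ℕ) (a h : ℝ) (v : ℝ → ℝ) (p : ℝ[X]) : Prop where
  natDegree_le : p.natDegree ≤ k
  left : p.eval a = v a
  right : p.eval (a + h) = v (a + h)
  moments : ∀ l, s ≤ l → l + 1 < s + k →
    ∫ t in a..(a + h), (t - a) ^ l * p.eval t = ∫ t in a..(a + h), (t - a) ^ l * v t

/-- The interpolant is as close to a polynomial as the interpolated function is. -/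
theorem exists_interpolant_stability (k s : ℕ) : ∃ K : ℝ, 0 < K ∧
    ∀ (a h B : ℝ) (v : ℝ → ℝ) (p q : ℝ[X]), 0 < h → ContinuousOn v (Icc a (a + h)) →
    IsCellInterpolant k s a h v p → q.natDegree ≤ k →
    (∀ t ∈ Icc a (a + h), |v t - q.eval t| ≤ B) →
    ∀ t ∈ Icc a (a + h), |p.eval t - q.eval t| ≤ K * B ∧
      |p.derivative.eval t - q.derivative.eval t| ≤ K * B / h := by
  obtain ⟨K, hK, hstab⟩ := exists_cell_stability k s
  refine ⟨K, hK, ?_⟩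
  intro a h B v p q hh hv hp hq hB t ht
  have hah : a ≤ a + h := by linarith
  -- Since $q$ reproduces itself, $p-q$ interpolates $v-q$; its degrees of freedom are therefore
  -- bounded through $\sup|v-q|\le B$.
  have key := hstab a h (p - q) B hh (natDegree_sub_le_of_le hp.natDegree_le hq |>.trans
    (by simp)) (by
      rw [eval_sub, hp.left]
      exact hB a (left_mem_Icc.2 hah)) (by
      rw [eval_sub, hp.right]
      exact hB _ (right_mem_Icc.2 hah)) (by
      intro l hl hlk
      have hvi : IntervalIntegrable (fun t => (t - a) ^ l * v t) MeasureTheory.volume a (a + h) := by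
        apply ContinuousOn.intervalIntegrable
        rw [uIcc_of_le hah]
        exact (by fun_prop : Continuous fun t : ℝ => (t - a) ^ l).continuousOn.mul hv
      have hpi : ∀ r : ℝ[X], IntervalIntegrable (fun t => (t - a) ^ l * r.eval t)
          MeasureTheory.volume a (a + h) := fun r => by
        apply Continuous.intervalIntegrable
        fun_prop
      have e : ∫ t in a..(a + h), (t - a) ^ l * (p - q).eval t
          = ∫ t in a..(a + h), (t - a) ^ l * (v t - q.eval t) := by
        simp only [eval_sub, mul_sub]
        rw [intervalIntegral.integral_sub (hpi p) (hpi q), hp.moments l hl hlk,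
          intervalIntegral.integral_sub hvi (hpi q)]
      rw [e]
      have hbd := intervalIntegral.norm_integral_le_of_norm_le_const (a := a) (b := a + h)
        (f := fun t => (t - a) ^ l * (v t - q.eval t)) (C := h ^ l * B) (by
          intro y hy
          rw [uIoc_of_le hah] at hy
          rw [Real.norm_eq_abs, abs_mul, abs_pow, abs_of_pos (by linarith [hy.1])]
          exact mul_le_mul (pow_le_pow_left₀ (by linarith [hy.1]) (by linarith [hy.2]) _)
            (hB y ⟨hy.1.le, hy.2⟩) (abs_nonneg _) (by positivity))
      rw [Real.norm_eq_abs] at hbd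
      refine hbd.trans_eq ?_
      rw [show a + h - a = h by ring, abs_of_pos hh]
      ring) t ht
  simpa only [derivative_sub, eval_sub] using key

/-- Interpolation error for functions with `k` derivatives. -/
theorem exists_interpolation_error (k s : ℕ) (hk : 1 ≤ k) : ∃ K : ℝ, 0 < K ∧
    ∀ (a h : ℝ) (g : ℕ → ℝ → ℝ) (p : ℝ[X]), 0 < h →
    (∀ j ≤ k, ContinuousOn (g j) (Icc a (a + h))) →
    (∀ j < k, ∀ t ∈ Ioo a (a + h), HasDerivAt (g j) (g (j + 1) t) t) →
    IsCellInterpolant k s a h (g 0) p →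
    ∀ t ∈ Icc a (a + h),
      |p.eval t - g 0 t| ≤ K * h ^ (k - 1) * ∫ y in a..(a + h), |g k y| := by
  obtain ⟨K, hK, hstab⟩ := exists_interpolant_stability k s
  refine ⟨K + 1, by linarith, ?_⟩
  intro a h g p hh hc hd hp t ht
  obtain ⟨m, rfl⟩ : ∃ m, k = m + 1 := ⟨k - 1, by omega⟩
  obtain ⟨q, hq, hqb⟩ := exists_taylor_approx m g hc hd
  rw [show a + h - a = h by ring] at hqb
  have h1 := (hstab a h _ (g 0) p q hh (hc 0 (by omega)) hp (by omega) hqb t ht).1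
  have h2 := hqb t ht
  rw [Nat.add_sub_cancel]
  calc |p.eval t - g 0 t| = |(p.eval t - q.eval t) - (g 0 t - q.eval t)| := by ring_nf
    _ ≤ |p.eval t - q.eval t| + |g 0 t - q.eval t| := abs_sub _ _
    _ ≤ _ := by linarith

/-- Interpolation error in the value and the slope for functions with `k + 1` derivatives. -/
theorem exists_interpolation_error_deriv (k s : ℕ) (hk : 1 ≤ k) : ∃ K : ℝ, 0 < K ∧
    ∀ (a h : ℝ) (g : ℕ → ℝ → ℝ) (p : ℝ[X]), 0 < h →
    (∀ j ≤ k + 1, ContinuousOn (g j) (Icc a (a + h))) →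
    (∀ j < k + 1, ∀ t ∈ Ioo a (a + h), HasDerivAt (g j) (g (j + 1) t) t) →
    IsCellInterpolant k s a h (g 0) p →
    ∀ t ∈ Icc a (a + h),
      |p.eval t - g 0 t| ≤ h * (K * h ^ (k - 1) * ∫ y in a..(a + h), |g (k + 1) y|) ∧
      |p.derivative.eval t - g 1 t| ≤ K * h ^ (k - 1) * ∫ y in a..(a + h), |g (k + 1) y| := by
  obtain ⟨K, hK, hstab⟩ := exists_interpolant_stability k s
  refine ⟨K + 1, by linarith, ?_⟩
  intro a h g p hh hc hd hp t ht
  obtain ⟨m, rfl⟩ : ∃ m, k = m + 1 := ⟨k - 1, by omega⟩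
  -- The polynomial $r$ approximates the first derivative, and its antiderivative $q$ below
  -- approximates the function. As $q'=r$, the same pair serves value and slope.
  obtain ⟨r, hr, hrb⟩ := exists_taylor_approx m (fun j => g (j + 1))
    (fun j hj => hc (j + 1) (by omega)) (fun j hj => hd (j + 1) (by omega))
  obtain ⟨q, hqr, hq, hqb⟩ := exists_approx_of_deriv (hc 0 (by omega)) (hd 0 (by omega)) hrb
  rw [show a + h - a = h by ring] at hqb hrb
  obtain ⟨h1, h1'⟩ := hstab a h _ (g 0) p q hh (hc 0 (by omega)) hp (by omega) hqb t ht
  have h2 := hqb t ht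
  have h2' := hrb t ht
  rw [Nat.add_sub_cancel]
  set M := ∫ y in a..(a + h), |g (m + 1 + 1) y|
  have e : K * (h * (h ^ m * M)) / h = K * (h ^ m * M) := by field_simp
  rw [e, hqr] at h1'
  constructor
  · calc |p.eval t - g 0 t| = |(p.eval t - q.eval t) - (g 0 t - q.eval t)| := by ring_nf
      _ ≤ |p.eval t - q.eval t| + |g 0 t - q.eval t| := abs_sub _ _
      _ ≤ K * (h * (h ^ m * M)) + h * (h ^ m * M) := add_le_add h1 h2
      _ = _ := by ring
  · calc |p.derivative.eval t - g 1 t|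
        = |(p.derivative.eval t - r.eval t) - (g 1 t - r.eval t)| := by ring_nf
      _ ≤ |p.derivative.eval t - r.eval t| + |g 1 t - r.eval t| := abs_sub _ _
      _ ≤ K * (h ^ m * M) + h ^ m * M := add_le_add h1' h2'
      _ = _ := by ring

/-- Cauchy–Schwarz against the constant 1, read off from $\int((b-a)|g|-M)^2\ge0$ with $M=\int|g|$.
-/
theorem sq_integral_abs_le {a b : ℝ} (hab : a ≤ b) {g : ℝ → ℝ} (hg : ContinuousOn g (Icc a b)) :
    (∫ t in a..b, |g t|) ^ 2 ≤ (b - a) * ∫ t in a..b, g t ^ 2 := by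
  set M := ∫ t in a..b, |g t| with hM
  rcases hab.eq_or_lt with rfl | hlt
  · simp [hM]
  have i1 : IntervalIntegrable (fun t => |g t|) MeasureTheory.volume a b :=
    ContinuousOn.intervalIntegrable (by rw [uIcc_of_le hab]; exact hg.abs)
  have i2 : IntervalIntegrable (fun t => g t ^ 2) MeasureTheory.volume a b :=
    ContinuousOn.intervalIntegrable (by rw [uIcc_of_le hab]; exact hg.pow 2)
  have h0 : 0 ≤ ∫ t in a..b, ((b - a) * |g t| - M) ^ 2 :=
    intervalIntegral.integral_nonneg hab fun _ _ => sq_nonneg _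
  have e : ∫ t in a..b, ((b - a) * |g t| - M) ^ 2
      = (b - a) * ((b - a) * (∫ t in a..b, g t ^ 2) - M ^ 2) := by
    have : (fun t => ((b - a) * |g t| - M) ^ 2)
        = fun t => (b - a) ^ 2 * g t ^ 2 - 2 * (b - a) * M * |g t| + M ^ 2 := by
      funext t
      rw [← sq_abs (g t)]
      ring
    rw [this, intervalIntegral.integral_add ((i2.const_mul _).sub (i1.const_mul _))
      intervalIntegrable_const, intervalIntegral.integral_sub (i2.const_mul _) (i1.const_mul _),
      intervalIntegral.integral_const_mul, intervalIntegral.integral_const_mul, ← hM,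
      intervalIntegral.integral_const]
    simp only [smul_eq_mul]
    ring
  rw [e] at h0
  have h1 := (mul_nonneg_iff_of_pos_left (by linarith)).1 h0
  linarith

/-- Summation of local error bounds by a weighted density `w`. -/
theorem integral_sq_le_of_cell_bound {N : ℕ} {x : ℕ → ℝ} (hx : IsPartition N x) {k : ℕ}
    (hk : 1 ≤ k) {K R : ℝ} {e g w : ℝ → ℝ} (he : PiecewiseCont N x e)
    (hg : ContinuousOn g unitI) (hw : ContinuousOn w unitI)
    (hbound : ∀ i < N, ∀ t ∈ Ioo (x i) (x (i + 1)),
      |e t| ≤ K * (x (i + 1) - x i) ^ (k - 1) * ∫ y in (x i)..(x (i + 1)), |g y|)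
    (hweight : ∀ i < N, ∀ t ∈ Ioo (x i) (x (i + 1)),
      (x (i + 1) - x i) ^ (2 * k) * g t ^ 2 ≤ R * w t) :
    ∫ t in (0 : ℝ)..1, e t ^ 2 ≤ K ^ 2 * (R * ∫ t in (0 : ℝ)..1, w t) := by
  have hwp : PiecewiseCont N x w := ContinuousOn.piecewiseCont hx hw
  have hgp : PiecewiseCont N x g := ContinuousOn.piecewiseCont hx hg
  rw [he.sq.integral_eq_sum hx, hwp.integral_eq_sum hx, Finset.mul_sum, Finset.mul_sum]
  refine Finset.sum_le_sum fun i hi => ?_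
  rw [Finset.mem_range] at hi
  have hlt := hx.lt_succ i hi
  set h := x (i + 1) - x i with hh
  have hpos : 0 < h := by linarith
  set M := ∫ y in (x i)..(x (i + 1)), |g y| with hM
  have hCS : M ^ 2 ≤ h * ∫ t in (x i)..(x (i + 1)), g t ^ 2 :=
    sq_integral_abs_le hlt.le (hg.mono (hx.cell_subset hi))
  have h1 : ∫ t in (x i)..(x (i + 1)), e t ^ 2 ≤ h * (K * h ^ (k - 1) * M) ^ 2 := by
    have := intervalIntegral.integral_mono_on_of_le_Ioo hlt.le
      (he.sq.intervalIntegrable_cell hx hi)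
      (intervalIntegrable_const (c := (K * h ^ (k - 1) * M) ^ 2))
      (fun t ht => by
        rw [← sq_abs]
        exact pow_le_pow_left₀ (abs_nonneg _) (hbound i hi t ht) 2)
    rwa [intervalIntegral.integral_const, smul_eq_mul] at this
  have h2 : h ^ (2 * k) * ∫ t in (x i)..(x (i + 1)), g t ^ 2
      ≤ R * ∫ t in (x i)..(x (i + 1)), w t := by
    rw [← intervalIntegral.integral_const_mul, ← intervalIntegral.integral_const_mul]
    exact intervalIntegral.integral_mono_on_of_le_Ioo hlt.le
      ((hgp.sq.intervalIntegrable_cell hx hi).const_mul _)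
      ((hwp.intervalIntegrable_cell hx hi).const_mul _) (hweight i hi)
  -- The power $h^{2k}$ is collected from $h^{2(k-1)}$ in the squared bound, one $h$ from
  -- integrating a constant, and one from Cauchy–Schwarz.
  have h3 : h * (K * h ^ (k - 1) * M) ^ 2 = K ^ 2 * (h ^ (2 * k - 1) * M ^ 2) := by
    obtain ⟨m, rfl⟩ : ∃ m, k = m + 1 := ⟨k - 1, by omega⟩
    rw [show 2 * (m + 1) - 1 = 2 * m + 1 by omega, Nat.add_sub_cancel]
    ring
  have h4 : h ^ (2 * k - 1) * (h * ∫ t in (x i)..(x (i + 1)), g t ^ 2)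
      = h ^ (2 * k) * ∫ t in (x i)..(x (i + 1)), g t ^ 2 := by
    rw [← mul_assoc, ← pow_succ, Nat.sub_add_cancel (by omega)]
  rw [h3] at h1
  refine h1.trans (mul_le_mul_of_nonneg_left ?_ (sq_nonneg K))
  calc h ^ (2 * k - 1) * M ^ 2
      ≤ h ^ (2 * k - 1) * (h * ∫ t in (x i)..(x (i + 1)), g t ^ 2) :=
        mul_le_mul_of_nonneg_left hCS (by positivity)
    _ ≤ _ := h4.trans_le h2

end approximation

/-! ### Finite element spaces, coercivity and unique solvability of the mixed problem -/

section finiteElements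
open Polynomial

variable {k N : ℕ} {x : ℕ → ℝ}

theorem IsFE.piecewiseC1 {v : ℝ → ℝ} (hv : IsFE k N x v) : PiecewiseC1 N x v := by
  intro i hi
  obtain ⟨p, -, hp⟩ := hv i hi
  have hc := (p.contDiff_aeval (𝕜 := ℝ) 1).contDiffOn (s := Icc (x i) (x (i + 1)))
  exact hc.congr fun t ht => (hp t ht).trans (coe_aeval_eq_eval t ▸ rfl)

theorem IsFE.add {u v : ℝ → ℝ} (hu : IsFE k N x u) (hv : IsFE k N x v) :
    IsFE k N x (fun t => u t + v t) := by
  intro i hi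
  obtain ⟨p, hp, hpu⟩ := hu i hi
  obtain ⟨q, hq, hqv⟩ := hv i hi
  exact ⟨p + q, (natDegree_add_le_of_le hp hq).trans (by simp), fun t ht => by
    simp only [hpu t ht, hqv t ht, eval_add]⟩

theorem IsFE.const_mul {u : ℝ → ℝ} (c : ℝ) (hu : IsFE k N x u) :
    IsFE k N x (fun t => c * u t) := by
  intro i hi
  obtain ⟨p, hp, hpu⟩ := hu i hi
  exact ⟨C c * p, (natDegree_C_mul_le c p).trans hp, fun t ht => by
    simp only [hpu t ht, eval_mul, eval_C]⟩

theorem IsFE.zero : IsFE k N x (fun _ => 0) :=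
  fun _ _ => ⟨0, by simp, fun _ _ => by simp⟩

theorem IsFE.sub {u v : ℝ → ℝ} (hu : IsFE k N x u) (hv : IsFE k N x v) :
    IsFE k N x (fun t => u t - v t) := by
  have h := hu.add (hv.const_mul (-1))
  simpa only [neg_one_mul, ← sub_eq_add_neg] using h

theorem IsFE.congr (hx : IsPartition N x) {u v : ℝ → ℝ} (hu : IsFE k N x u)
    (h : EqOn v u unitI) : IsFE k N x v := by
  intro i hi
  obtain ⟨p, hp, hpu⟩ := hu i hi
  exact ⟨p, hp, fun t ht => (h (hx.cell_subset hi ht)).trans (hpu t ht)⟩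

theorem deriv_eq_of_eqOn_unitI {u v : ℝ → ℝ} (h : EqOn u v unitI) {t : ℝ}
    (ht : t ∈ Ioo (0 : ℝ) 1) : deriv u t = deriv v t :=
  (h.eventuallyEq_of_mem (Icc_mem_nhds ht.1 ht.2)).deriv_eq

/-- The finite element functions, extended by zero outside of `[0,1]`. -/
def feSpace (k N : ℕ) (x : ℕ → ℝ) : Submodule ℝ (ℝ → ℝ) where
  carrier := {v | IsFE k N x v ∧ ∀ t, t ∉ unitI → v t = 0}
  add_mem' {u v} hu hv := ⟨hu.1.add hv.1, fun t ht => by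
    rw [Pi.add_apply, hu.2 t ht, hv.2 t ht, add_zero]⟩
  zero_mem' := ⟨IsFE.zero, fun _ _ => rfl⟩
  smul_mem' c v hv := ⟨hv.1.const_mul c, fun t ht => by
    rw [Pi.smul_apply, hv.2 t ht, smul_zero]⟩

/-- The finite element functions that vanish at the end points of `[0,1]`. -/
def feSpaceZero (k N : ℕ) (x : ℕ → ℝ) : Submodule ℝ (ℝ → ℝ) where
  carrier := {v | v ∈ feSpace k N x ∧ v 0 = 0 ∧ v 1 = 0}
  add_mem' {u v} hu hv := ⟨add_mem hu.1 hv.1, by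
    rw [Pi.add_apply, hu.2.1, hv.2.1, add_zero], by
    rw [Pi.add_apply, hu.2.2, hv.2.2, add_zero]⟩
  zero_mem' := ⟨zero_mem _, rfl, rfl⟩
  smul_mem' c v hv := ⟨Submodule.smul_mem _ c hv.1, by
    rw [Pi.smul_apply, hv.2.1, smul_zero], by rw [Pi.smul_apply, hv.2.2, smul_zero]⟩

/-- A polynomial of degree at most $k$ is determined by $k+1$ values, so finitely many evaluations
separate the functions; outside $[0,1]$ they are zero by definition. -/
theorem finiteDimensional_feSpace (hx : IsPartition N x) :
    FiniteDimensional ℝ (feSpace k N x) := by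
  -- Any $k+1$ distinct points of the closed cell would do. The fractions $(j+1)/(k+1)$ avoid a
  -- division by zero for $k=0$.
  let node : Fin N → Fin (k + 1) → ℝ := fun i j =>
    x i + ((j : ℝ) + 1) / (k + 1) * (x (i + 1) - x i)
  let ev : feSpace k N x →ₗ[ℝ] (Fin N → Fin (k + 1) → ℝ) :=
    { toFun := fun v i j => v.1 (node i j)
      map_add' := fun _ _ => rfl
      map_smul' := fun _ _ => rfl }
  refine FiniteDimensional.of_injective ev ?_
  rw [injective_iff_map_eq_zero]
  intro v hv
  refine Subtype.ext (funext fun t => ?_)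
  by_cases ht : t ∈ unitI
  · obtain ⟨i, hi, hti⟩ := hx.exists_cell ht
    obtain ⟨p, hp, hpv⟩ := v.2.1 i hi
    have hlt := hx.lt_succ i hi
    have hp0 : p = 0 := by
      refine eq_zero_of_natDegree_lt_card_of_eval_eq_zero p (f := node ⟨i, hi⟩) ?_ ?_ ?_
      · intro j l hjl
        have hne : x (i + 1) - x i ≠ 0 := by linarith
        have h1 := mul_right_cancel₀ hne (add_left_cancel hjl)
        have hk : (k : ℝ) + 1 ≠ 0 := by positivity
        rw [div_left_inj' hk] at h1
        exact Fin.ext (by exact_mod_cast add_right_cancel h1)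
      · intro j
        have hj : (j : ℝ) ≤ k := by exact_mod_cast Nat.lt_succ_iff.1 j.2
        have h0 : 0 ≤ ((j : ℝ) + 1) / (k + 1) := by positivity
        have h1 : ((j : ℝ) + 1) / (k + 1) ≤ 1 := by
          rw [div_le_one (by positivity)]
          linarith
        have hmem : node ⟨i, hi⟩ j ∈ Icc (x i) (x (i + 1)) := by
          constructor <;> simp only [node] <;> nlinarith
        rw [← hpv _ hmem]
        exact congrFun (congrFun hv ⟨i, hi⟩) j
      · simpa using Nat.lt_succ_of_le hp
    rw [hpv t hti, hp0, eval_zero]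
    rfl
  · exact v.2.2 t ht

/-- The integrand of the bilinear form of the mixed problem. -/
noncomputable def mixedIntegrand (ε : ℝ) (b d u w ψ φ : ℝ → ℝ) (t : ℝ) : ℝ :=
  (ε * (deriv u t * deriv φ t) + w t * φ t)
    + (b t * deriv u t * deriv ψ t + deriv b t * deriv u t * ψ t + d t * u t * ψ t
      - ε * (deriv w t * deriv ψ t))

theorem piecewiseCont_mixedIntegrand (hx : IsPartition N x) (ε : ℝ) {b d u w ψ φ : ℝ → ℝ}
    (hb : PiecewiseC1 N x b) (hd : PiecewiseCont N x d) (hu : PiecewiseC1 N x u)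
    (hw : PiecewiseC1 N x w) (hψ : PiecewiseC1 N x ψ) (hφ : PiecewiseC1 N x φ) :
    PiecewiseCont N x (mixedIntegrand ε b d u w ψ φ) := by
  have hu' := hu.deriv hx
  have hw' := hw.deriv hx
  have hb' := hb.deriv hx
  have hψ' := hψ.deriv hx
  have hφ' := hφ.deriv hx
  have hε : PiecewiseCont N x (fun _ => ε) := PiecewiseCont.const ε
  exact ((hε.mul (hu'.mul hφ')).add (hw.piecewiseCont.mul hφ.piecewiseCont)).add
    (((((hb.piecewiseCont.mul hu').mul hψ').add ((hb'.mul hu').mul hψ.piecewiseCont)).add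
      ((hd.mul hu.piecewiseCont).mul hψ.piecewiseCont)).sub (hε.mul (hw'.mul hψ')))

theorem integral_first_part (hx : IsPartition N x) (ε : ℝ) {u w φ : ℝ → ℝ}
    (hu : PiecewiseC1 N x u) (hw : PiecewiseC1 N x w) (hφ : PiecewiseC1 N x φ) :
    ∫ t in (0 : ℝ)..1, (ε * (deriv u t * deriv φ t) + w t * φ t)
      = ε * (∫ t in (0 : ℝ)..1, deriv u t * deriv φ t) + ∫ t in (0 : ℝ)..1, w t * φ t := by
  have h1 := ((hu.deriv hx).mul (hφ.deriv hx)).intervalIntegrable hx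
  have h2 := (hw.piecewiseCont.mul hφ.piecewiseCont).intervalIntegrable hx
  rw [intervalIntegral.integral_add (h1.const_mul ε) h2, intervalIntegral.integral_const_mul]

theorem integral_second_part (hx : IsPartition N x) (ε : ℝ) {b d u w ψ : ℝ → ℝ}
    (hb : PiecewiseC1 N x b) (hd : PiecewiseCont N x d) (hu : PiecewiseC1 N x u)
    (hw : PiecewiseC1 N x w) (hψ : PiecewiseC1 N x ψ) :
    ∫ t in (0 : ℝ)..1, (b t * deriv u t * deriv ψ t + deriv b t * deriv u t * ψ t
        + d t * u t * ψ t - ε * (deriv w t * deriv ψ t))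
      = (∫ t in (0 : ℝ)..1, b t * deriv u t * deriv ψ t)
      + (∫ t in (0 : ℝ)..1, deriv b t * deriv u t * ψ t)
      + (∫ t in (0 : ℝ)..1, d t * u t * ψ t)
      - ε * (∫ t in (0 : ℝ)..1, deriv w t * deriv ψ t) := by
  have hu' := hu.deriv hx
  have hψ' := hψ.deriv hx
  have h1 := ((hb.piecewiseCont.mul hu').mul hψ').intervalIntegrable hx
  have h2 := (((hb.deriv hx).mul hu').mul hψ.piecewiseCont).intervalIntegrable hx
  have h3 := ((hd.mul hu.piecewiseCont).mul hψ.piecewiseCont).intervalIntegrable hx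
  have h4 := ((hw.deriv hx).mul hψ').intervalIntegrable hx
  rw [intervalIntegral.integral_sub ((h1.add h2).add h3) (h4.const_mul ε),
    intervalIntegral.integral_add (h1.add h2) h3, intervalIntegral.integral_add h1 h2,
    intervalIntegral.integral_const_mul]

/-- The mixed problem tested with a pair of functions. -/
theorem IsMixedFESolution.integral_mixedIntegrand (hx : IsPartition N x) {ε : ℝ}
    {b d f uH wH ψ φ : ℝ → ℝ} (hb : PiecewiseC1 N x b) (hd : PiecewiseCont N x d)
    (h : IsMixedFESolution k N x ε b d f uH wH) (hψ : IsFE k N x ψ) (hψ0 : ψ 0 = 0)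
    (hψ1 : ψ 1 = 0) (hφ : IsFE k N x φ) :
    ∫ t in (0 : ℝ)..1, mixedIntegrand ε b d uH wH ψ φ t = ∫ t in (0 : ℝ)..1, f t * ψ t := by
  have hu := h.mem_u.piecewiseC1
  have hw := h.mem_w.piecewiseC1
  have hψ' := hψ.piecewiseC1
  have hφ' := hφ.piecewiseC1
  have hε : PiecewiseCont N x (fun _ => ε) := PiecewiseCont.const ε
  have i1 := ((hε.mul ((hu.deriv hx).mul (hφ'.deriv hx))).add
    (hw.piecewiseCont.mul hφ'.piecewiseCont)).intervalIntegrable hx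
  have i2 := (((((hb.piecewiseCont.mul (hu.deriv hx)).mul (hψ'.deriv hx)).add
    (((hb.deriv hx).mul (hu.deriv hx)).mul hψ'.piecewiseCont)).add
      ((hd.mul hu.piecewiseCont).mul hψ'.piecewiseCont)).sub
      (hε.mul ((hw.deriv hx).mul (hψ'.deriv hx)))).intervalIntegrable hx
  simp only [mixedIntegrand]
  rw [intervalIntegral.integral_add i1 i2, integral_first_part hx ε hu hw hφ',
    integral_second_part hx ε hb hd hu hw hψ', h.first φ hφ, h.second ψ hψ hψ0 hψ1, zero_add]

/-- Coercivity identity: `(u', (b u)') + (d u, u) = (b u', u') + ((d - b''/2) u, u)`. -/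
theorem integral_convection_identity (hx : IsPartition N x) {b d ξ : ℝ → ℝ}
    (hb : ContDiffOn ℝ 2 b unitI) (hd : PiecewiseCont N x d) (hξ : PiecewiseC1 N x ξ)
    (h0 : ξ 0 = 0) (h1 : ξ 1 = 0) :
    ∫ t in (0 : ℝ)..1, (b t * deriv ξ t * deriv ξ t + deriv b t * deriv ξ t * ξ t
        + d t * ξ t * ξ t)
      = ∫ t in (0 : ℝ)..1, (b t * deriv ξ t ^ 2 + (d t - derivI 2 b t / 2) * ξ t ^ 2) := by
  have hb1 : PiecewiseC1 N x b :=
    ContDiffOn.piecewiseC1 hx (hb.of_le (by norm_num))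
  have hB : PiecewiseC1 N x (derivI 1 b) :=
    ContDiffOn.piecewiseC1 hx (contDiffOn_derivI (r := 2) (by exact_mod_cast hb) (by norm_num))
  have hbp := hb1.piecewiseCont
  have hb' := hb1.deriv hx
  have hξp := hξ.piecewiseCont
  have hξ' := hξ.deriv hx
  have hB2 : PiecewiseCont N x (derivI 2 b) :=
    ContinuousOn.piecewiseCont hx (continuousOn_derivI (r := 2) (by exact_mod_cast hb) le_rfl)
  have hsq := hξ.mul hξ
  have hparts := hB.integral_by_parts hx hsq
  rw [h0, h1] at hparts
  have iL := ((((hbp.mul hξ').mul hξ').add ((hb'.mul hξ').mul hξp)).add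
    ((hd.mul hξp).mul hξp)).intervalIntegrable hx
  have pR : PiecewiseCont N x
      (fun t => b t * deriv ξ t ^ 2 + (d t - derivI 2 b t / 2) * ξ t ^ 2) := by
    have := (hbp.mul hξ'.sq).add ((hd.sub (hB2.mul (PiecewiseCont.const (2⁻¹)))).mul hξp.sq)
    simpa only [div_eq_mul_inv] using this
  have iR := pR.intervalIntegrable hx
  rw [← sub_eq_zero, ← intervalIntegral.integral_sub iL iR]
  -- The two integrands differ by $\tfrac12(b'\xi^2)'$, whose integral vanishes because $\xi$ does
  -- at both ends.
  have hP := ((hB.deriv hx).mul hsq.piecewiseCont).add (hB.piecewiseCont.mul (hsq.deriv hx))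
  have e := (hP.mul (PiecewiseCont.const (2⁻¹))).integral_congr hx
    (f := fun t => b t * deriv ξ t * deriv ξ t + deriv b t * deriv ξ t * ξ t
        + d t * ξ t * ξ t - (b t * deriv ξ t ^ 2 + (d t - derivI 2 b t / 2) * ξ t ^ 2)) (by
      intro t ht
      have ht' := hx.cellInteriors_subset ht
      have e1 : deriv b t = derivI 1 b t := by
        have h := hasDerivAt_derivI (r := 2) (v := b) (by exact_mod_cast hb) (j := 0)
          (by norm_num) ht'
        rw [derivI_zero] at h
        exact h.deriv
      have e2 : deriv (derivI 1 b) t = derivI 2 b t :=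
        (hasDerivAt_derivI (r := 2) (v := b) (by exact_mod_cast hb) (j := 1)
          (by norm_num) ht').deriv
      have e3 := hξ.deriv_mul hξ ht
      simp only [e1, e2, e3]
      ring)
  rw [e, intervalIntegral.integral_mul_const, hparts]
  simp

/-- The mixed bilinear form is coercive. -/
theorem mixed_coercive (hx : IsPartition N x) {ε β δ : ℝ} {b d u w : ℝ → ℝ}
    (hb : ContDiffOn ℝ 2 b unitI) (hd : ContinuousOn d unitI)
    (hβ : ∀ t ∈ unitI, β ≤ b t) (hδ : ∀ t ∈ unitI, δ ≤ d t - derivI 2 b t / 2)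
    (hu : PiecewiseC1 N x u) (hw : PiecewiseC1 N x w) (h0 : u 0 = 0) (h1 : u 1 = 0) :
    ∫ t in (0 : ℝ)..1, (β * deriv u t ^ 2 + δ * u t ^ 2 + w t ^ 2)
      ≤ ∫ t in (0 : ℝ)..1, mixedIntegrand ε b d u w u w t := by
  have hb1 : PiecewiseC1 N x b :=
    ContDiffOn.piecewiseC1 hx (hb.of_le (by norm_num))
  have hdp : PiecewiseCont N x d := ContinuousOn.piecewiseCont hx hd
  have hbp := hb1.piecewiseCont
  have hb' := hb1.deriv hx
  have hup := hu.piecewiseCont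
  have hu' := hu.deriv hx
  have hwp := hw.piecewiseCont
  have hB2 : PiecewiseCont N x (derivI 2 b) :=
    ContinuousOn.piecewiseCont hx (continuousOn_derivI (r := 2) (by exact_mod_cast hb) le_rfl)
  have pR : PiecewiseCont N x
      (fun t => b t * deriv u t ^ 2 + (d t - derivI 2 b t / 2) * u t ^ 2) := by
    have := (hbp.mul hu'.sq).add ((hdp.sub (hB2.mul (PiecewiseCont.const (2⁻¹)))).mul hup.sq)
    simpa only [div_eq_mul_inv] using this
  have pL := (((hbp.mul hu').mul hu').add ((hb'.mul hu').mul hup)).add ((hdp.mul hup).mul hup)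
  -- With $(\psi,\varphi)=(u,w)$ the terms $\varepsilon u'w'$ and $-\varepsilon w'u'$ cancel
  -- pointwise.
  have e : ∫ t in (0 : ℝ)..1, mixedIntegrand ε b d u w u w t
      = ∫ t in (0 : ℝ)..1,
        ((b t * deriv u t ^ 2 + (d t - derivI 2 b t / 2) * u t ^ 2) + w t ^ 2) := by
    rw [intervalIntegral.integral_add (pR.intervalIntegrable hx)
      (hwp.sq.intervalIntegrable hx), ← integral_convection_identity hx hb hdp hu h0 h1,
      ← intervalIntegral.integral_add (pL.intervalIntegrable hx) (hwp.sq.intervalIntegrable hx)]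
    congr 1
    funext t
    simp only [mixedIntegrand]
    ring
  rw [e]
  refine PiecewiseCont.integral_mono hx
    ((((PiecewiseCont.const β).mul hu'.sq).add ((PiecewiseCont.const δ).mul hup.sq)).add hwp.sq)
    (pR.add hwp.sq) fun t ht => ?_
  have ht' := Ioo_subset_Icc_self (hx.cellInteriors_subset ht)
  have i1 := mul_le_mul_of_nonneg_right (hβ t ht') (sq_nonneg (deriv u t))
  have i2 := mul_le_mul_of_nonneg_right (hδ t ht') (sq_nonneg (u t))
  linarith

/-- Coercivity with lower bound 0 for $b$ is enough: $\delta\|u\|^2+\|w\|^2\le0$ already forces both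
to vanish. This serves uniqueness as well as existence. -/
theorem eq_zero_of_mixed_le_zero (hx : IsPartition N x) {ε δ : ℝ} {b d u w : ℝ → ℝ}
    (hb : ContDiffOn ℝ 2 b unitI) (hd : ContinuousOn d unitI)
    (hbpos : ∀ t ∈ unitI, 0 < b t) (hδ : 0 < δ)
    (hbd : ∀ t ∈ unitI, δ < d t - derivI 2 b t / 2)
    (hu : PiecewiseC1 N x u) (hw : PiecewiseC1 N x w) (h0 : u 0 = 0) (h1 : u 1 = 0)
    (h : ∫ t in (0 : ℝ)..1, mixedIntegrand ε b d u w u w t ≤ 0) :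
    (∀ t ∈ unitI, u t = 0) ∧ ∀ t ∈ unitI, w t = 0 := by
  have hc := (mixed_coercive (ε := ε) hx hb hd (fun t ht => (hbpos t ht).le)
    (fun t ht => (hbd t ht).le) hu hw h0 h1).trans h
  have iu := (hu.piecewiseCont.sq).intervalIntegrable hx
  have iw := (hw.piecewiseCont.sq).intervalIntegrable hx
  have e : ∫ t in (0 : ℝ)..1, (0 * deriv u t ^ 2 + δ * u t ^ 2 + w t ^ 2)
      = δ * (∫ t in (0 : ℝ)..1, u t ^ 2) + ∫ t in (0 : ℝ)..1, w t ^ 2 := by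
    rw [← intervalIntegral.integral_const_mul,
      ← intervalIntegral.integral_add (iu.const_mul δ) iw]
    simp only [zero_mul, zero_add]
  rw [e] at hc
  have n1 : 0 ≤ ∫ t in (0 : ℝ)..1, u t ^ 2 :=
    intervalIntegral.integral_nonneg zero_le_one fun _ _ => sq_nonneg _
  have n2 : 0 ≤ ∫ t in (0 : ℝ)..1, w t ^ 2 :=
    intervalIntegral.integral_nonneg zero_le_one fun _ _ => sq_nonneg _
  have n3 := mul_nonneg hδ.le n1
  refine ⟨PiecewiseC1.eq_zero_of_integral_sq hx hu ?_,
    PiecewiseC1.eq_zero_of_integral_sq hx hw (by linarith)⟩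
  by_contra! hpos
  have := mul_pos hδ hpos
  linarith

theorem mixedIntegrand_sub {ε : ℝ} {b d u w u' w' ψ φ : ℝ → ℝ} (hu : PiecewiseC1 N x u)
    (hw : PiecewiseC1 N x w) (hu' : PiecewiseC1 N x u') (hw' : PiecewiseC1 N x w') :
    EqOn (mixedIntegrand ε b d (fun t => u t - u' t) (fun t => w t - w' t) ψ φ)
      (fun t => mixedIntegrand ε b d u w ψ φ t - mixedIntegrand ε b d u' w' ψ φ t)
      (cellInteriors N x) := by
  intro t ht
  simp only [mixedIntegrand, hu.deriv_sub hu' ht, hw.deriv_sub hw' ht]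
  ring

/-- Uniqueness of the mixed finite element solution. -/
theorem IsMixedFESolution.unique (hx : IsPartition N x) {ε δ : ℝ} {b d f : ℝ → ℝ}
    (hb : ContDiffOn ℝ 2 b unitI) (hd : ContinuousOn d unitI)
    (hbpos : ∀ t ∈ unitI, 0 < b t) (hδ : 0 < δ)
    (hbd : ∀ t ∈ unitI, δ < d t - derivI 2 b t / 2) {uH wH uH' wH' : ℝ → ℝ}
    (h : IsMixedFESolution k N x ε b d f uH wH) (h' : IsMixedFESolution k N x ε b d f uH' wH') :
    EqOn uH uH' unitI ∧ EqOn wH wH' unitI := by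
  have hb1 : PiecewiseC1 N x b := ContDiffOn.piecewiseC1 hx (hb.of_le (by norm_num))
  have hdp : PiecewiseCont N x d := ContinuousOn.piecewiseCont hx hd
  have hξ := h.mem_u.sub h'.mem_u
  have hη := h.mem_w.sub h'.mem_w
  have h0 : uH 0 - uH' 0 = 0 := by rw [h.left_value, h'.left_value, sub_zero]
  have h1 : uH 1 - uH' 1 = 0 := by rw [h.right_value, h'.right_value, sub_zero]
  have p := piecewiseCont_mixedIntegrand hx ε hb1 hdp h.mem_u.piecewiseC1 h.mem_w.piecewiseC1
    hξ.piecewiseC1 hη.piecewiseC1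
  have p' := piecewiseCont_mixedIntegrand hx ε hb1 hdp h'.mem_u.piecewiseC1
    h'.mem_w.piecewiseC1 hξ.piecewiseC1 hη.piecewiseC1
  have e := (p.sub p').integral_congr hx (mixedIntegrand_sub h.mem_u.piecewiseC1
    h.mem_w.piecewiseC1 h'.mem_u.piecewiseC1 h'.mem_w.piecewiseC1)
  rw [intervalIntegral.integral_sub (p.intervalIntegrable hx) (p'.intervalIntegrable hx),
    h.integral_mixedIntegrand hx hb1 hdp hξ h0 h1 hη,
    h'.integral_mixedIntegrand hx hb1 hdp hξ h0 h1 hη, sub_self] at e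
  obtain ⟨z1, z2⟩ := eq_zero_of_mixed_le_zero hx hb hd hbpos hδ hbd hξ.piecewiseC1
    hη.piecewiseC1 h0 h1 e.le
  exact ⟨fun t ht => sub_eq_zero.1 (z1 t ht), fun t ht => sub_eq_zero.1 (z2 t ht)⟩

/-- The bilinear form of the mixed problem on the finite element spaces. -/
noncomputable def mixedForm (k : ℕ) (hx : IsPartition N x) (ε : ℝ) {b d : ℝ → ℝ}
    (hb : PiecewiseC1 N x b) (hd : PiecewiseCont N x d) :
    (feSpaceZero k N x × feSpace k N x) →ₗ[ℝ]
      Module.Dual ℝ (feSpaceZero k N x × feSpace k N x) :=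
  have hc : ∀ p q : feSpaceZero k N x × feSpace k N x,
      PiecewiseCont N x (mixedIntegrand ε b d p.1.1 p.2.1 q.1.1 q.2.1) := fun p q =>
    piecewiseCont_mixedIntegrand hx ε hb hd p.1.2.1.1.piecewiseC1 p.2.2.1.piecewiseC1
      q.1.2.1.1.piecewiseC1 q.2.2.1.piecewiseC1
  LinearMap.mk₂ ℝ (fun p q => ∫ t in (0 : ℝ)..1, mixedIntegrand ε b d p.1.1 p.2.1 q.1.1 q.2.1 t)
    (fun p p' q => by
      rw [← intervalIntegral.integral_add ((hc p q).intervalIntegrable hx)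
        ((hc p' q).intervalIntegrable hx)]
      -- Additivity of `deriv` needs differentiability of both summands and is used on open cells
      -- only; homogeneity holds at every point.
      refine ((hc p q).add (hc p' q)).integral_congr hx fun t ht => ?_
      have e1 : deriv ((p + p').1 : ℝ → ℝ) t = deriv p.1.1 t + deriv p'.1.1 t :=
        p.1.2.1.1.piecewiseC1.deriv_add p'.1.2.1.1.piecewiseC1 ht
      have e2 : deriv ((p + p').2 : ℝ → ℝ) t = deriv p.2.1 t + deriv p'.2.1 t :=
        p.2.2.1.piecewiseC1.deriv_add p'.2.2.1.piecewiseC1 ht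
      have e3 : ((p + p').1 : ℝ → ℝ) t = p.1.1 t + p'.1.1 t := rfl
      have e4 : ((p + p').2 : ℝ → ℝ) t = p.2.1 t + p'.2.1 t := rfl
      simp only [mixedIntegrand, e1, e2, e3, e4]
      ring)
    (fun c p q => by
      rw [smul_eq_mul, ← intervalIntegral.integral_const_mul]
      congr 1
      funext t
      have e1 : deriv ((c • p).1 : ℝ → ℝ) t = c * deriv p.1.1 t := deriv_const_mul_field c
      have e2 : deriv ((c • p).2 : ℝ → ℝ) t = c * deriv p.2.1 t := deriv_const_mul_field c
      have e3 : ((c • p).1 : ℝ → ℝ) t = c * p.1.1 t := rfl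
      have e4 : ((c • p).2 : ℝ → ℝ) t = c * p.2.1 t := rfl
      simp only [mixedIntegrand, e1, e2, e3, e4]
      ring)
    (fun q p p' => by
      rw [← intervalIntegral.integral_add ((hc q p).intervalIntegrable hx)
        ((hc q p').intervalIntegrable hx)]
      refine ((hc q p).add (hc q p')).integral_congr hx fun t ht => ?_
      have e1 : deriv ((p + p').1 : ℝ → ℝ) t = deriv p.1.1 t + deriv p'.1.1 t :=
        p.1.2.1.1.piecewiseC1.deriv_add p'.1.2.1.1.piecewiseC1 ht
      have e2 : deriv ((p + p').2 : ℝ → ℝ) t = deriv p.2.1 t + deriv p'.2.1 t :=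
        p.2.2.1.piecewiseC1.deriv_add p'.2.2.1.piecewiseC1 ht
      have e3 : ((p + p').1 : ℝ → ℝ) t = p.1.1 t + p'.1.1 t := rfl
      have e4 : ((p + p').2 : ℝ → ℝ) t = p.2.1 t + p'.2.1 t := rfl
      simp only [mixedIntegrand, e1, e2, e3, e4]
      ring)
    (fun c q p => by
      rw [smul_eq_mul, ← intervalIntegral.integral_const_mul]
      congr 1
      funext t
      have e1 : deriv ((c • p).1 : ℝ → ℝ) t = c * deriv p.1.1 t := deriv_const_mul_field c
      have e2 : deriv ((c • p).2 : ℝ → ℝ) t = c * deriv p.2.1 t := deriv_const_mul_field c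
      have e3 : ((c • p).1 : ℝ → ℝ) t = c * p.1.1 t := rfl
      have e4 : ((c • p).2 : ℝ → ℝ) t = c * p.2.1 t := rfl
      simp only [mixedIntegrand, e1, e2, e3, e4]
      ring)

/-- The load functional of the mixed problem. -/
noncomputable def loadForm (k : ℕ) (hx : IsPartition N x) {f : ℝ → ℝ}
    (hf : PiecewiseCont N x f) : Module.Dual ℝ (feSpaceZero k N x × feSpace k N x) where
  toFun q := ∫ t in (0 : ℝ)..1, f t * q.1.1 t
  map_add' p q := by
    rw [← intervalIntegral.integral_add
      ((hf.mul p.1.2.1.1.piecewiseC1.piecewiseCont).intervalIntegrable hx)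
      ((hf.mul q.1.2.1.1.piecewiseC1.piecewiseCont).intervalIntegrable hx)]
    congr 1
    funext t
    exact mul_add _ _ _
  map_smul' c p := by
    rw [RingHom.id_apply, smul_eq_mul, ← intervalIntegral.integral_const_mul]
    congr 1
    funext t
    exact mul_left_comm _ _ _

theorem IsFE.indicator_mem (hx : IsPartition N x) {v : ℝ → ℝ} (hv : IsFE k N x v) :
    unitI.indicator v ∈ feSpace k N x :=
  ⟨hv.congr hx (eqOn_indicator), fun _ ht => indicator_of_notMem ht v⟩

/-- Existence of the mixed finite element solution. -/
theorem exists_mixedFESolution (hx : IsPartition N x) {ε δ : ℝ} {b d f : ℝ → ℝ}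
    (hb : ContDiffOn ℝ 2 b unitI) (hd : ContinuousOn d unitI)
    (hbpos : ∀ t ∈ unitI, 0 < b t) (hδ : 0 < δ)
    (hbd : ∀ t ∈ unitI, δ < d t - derivI 2 b t / 2) (hf : PiecewiseCont N x f) :
    ∃ uH wH : ℝ → ℝ, IsMixedFESolution k N x ε b d f uH wH := by
  have hb1 : PiecewiseC1 N x b := ContDiffOn.piecewiseC1 hx (hb.of_le (by norm_num))
  have hdp : PiecewiseCont N x d := ContinuousOn.piecewiseCont hx hd
  have : FiniteDimensional ℝ (feSpace k N x) := finiteDimensional_feSpace hx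
  have : FiniteDimensional ℝ (feSpaceZero k N x) :=
    Submodule.finiteDimensional_of_le (S₂ := feSpace k N x) fun _ hv => hv.1
  have hinj : Function.Injective (mixedForm k hx ε hb1 hdp) := by
    rw [injective_iff_map_eq_zero]
    intro p hp
    have h0 : ∫ t in (0 : ℝ)..1, mixedIntegrand ε b d p.1.1 p.2.1 p.1.1 p.2.1 t = 0 :=
      LinearMap.congr_fun hp p
    obtain ⟨z1, z2⟩ := eq_zero_of_mixed_le_zero hx hb hd hbpos hδ hbd
      p.1.2.1.1.piecewiseC1 p.2.2.1.piecewiseC1 p.1.2.2.1 p.1.2.2.2 h0.le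
    refine Prod.ext (Subtype.ext (funext fun t => ?_)) (Subtype.ext (funext fun t => ?_))
    · by_cases ht : t ∈ unitI
      · exact z1 t ht
      · exact p.1.2.1.2 t ht
    · by_cases ht : t ∈ unitI
      · exact z2 t ht
      · exact p.2.2.2 t ht
  -- A finite-dimensional space and its dual have equal dimension, so injectivity of the form yields
  -- a preimage of the load.
  obtain ⟨⟨u, w⟩, hp⟩ := (LinearMap.injective_iff_surjective_of_finrank_eq_finrank
    Subspace.dual_finrank_eq.symm).1 hinj (loadForm k hx hf)
  have key : ∀ (ψ : feSpaceZero k N x) (φ : feSpace k N x),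
      ∫ t in (0 : ℝ)..1, mixedIntegrand ε b d u.1 w.1 ψ.1 φ.1 t
        = ∫ t in (0 : ℝ)..1, f t * ψ.1 t := fun ψ φ => LinearMap.congr_fun hp (ψ, φ)
  have hu := u.2.1.1.piecewiseC1
  have hw := w.2.1.piecewiseC1
  refine ⟨u.1, w.1, u.2.1.1, w.2.1, u.2.2.1, u.2.2.2, ?_, ?_⟩
  · intro φ hφ
    rw [← integral_first_part hx ε hu hw hφ.piecewiseC1]
    -- Testing with $\psi=0$ isolates the first equation. The form accepts only functions extended
    -- by zero, so $\varphi$ is truncated; nothing changes inside $(0,1)$.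
    have h := key 0 ⟨_, hφ.indicator_mem hx⟩
    have hz : ((0 : feSpaceZero k N x) : ℝ → ℝ) = fun _ => 0 := rfl
    simp only [hz, mul_zero, intervalIntegral.integral_zero] at h
    refine Eq.trans ?_ h
    have hcont := piecewiseCont_mixedIntegrand hx ε hb1 hdp hu hw
      (IsFE.zero (k := k) (N := N) (x := x)).piecewiseC1 (hφ.indicator_mem hx).1.piecewiseC1
    refine hcont.integral_congr hx fun t ht => ?_
    have ht' := hx.cellInteriors_subset ht
    have e1 := deriv_eq_of_eqOn_unitI (eqOn_indicator (s := unitI) (f := φ)) ht'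
    have e2 := eqOn_indicator (s := unitI) (f := φ) (Ioo_subset_Icc_self ht')
    simp only [mixedIntegrand, e1, e2, deriv_const]
    ring
  · intro ψ hψ h0 h1
    rw [← integral_second_part hx ε hb1 hdp hu hw hψ.piecewiseC1]
    have m0 : unitI.indicator ψ ∈ feSpaceZero k N x := by
      refine ⟨hψ.indicator_mem hx, ?_, ?_⟩
      · rw [indicator_of_mem (by simp), h0]
      · rw [indicator_of_mem (by simp), h1]
    have h := key ⟨_, m0⟩ 0
    have hz : ((0 : feSpace k N x) : ℝ → ℝ) = fun _ => 0 := rfl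
    simp only [hz] at h
    have hfψ : ∫ t in (0 : ℝ)..1, f t * ψ t
        = ∫ t in (0 : ℝ)..1, f t * unitI.indicator ψ t := by
      refine (hf.mul m0.1.1.piecewiseC1.piecewiseCont).integral_congr hx fun t ht => ?_
      have e2 := eqOn_indicator (s := unitI) (f := ψ)
        (Ioo_subset_Icc_self (hx.cellInteriors_subset ht))
      simp only [e2]
    rw [hfψ, ← h]
    have hcont := piecewiseCont_mixedIntegrand hx ε hb1 hdp hu hw m0.1.1.piecewiseC1
      (IsFE.zero (k := k) (N := N) (x := x)).piecewiseC1
    refine hcont.integral_congr hx fun t ht => ?_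
    have ht' := hx.cellInteriors_subset ht
    have e1 := deriv_eq_of_eqOn_unitI (eqOn_indicator (s := unitI) (f := ψ)) ht'
    have e2 := eqOn_indicator (s := unitI) (f := ψ) (Ioo_subset_Icc_self ht')
    simp only [mixedIntegrand, e1, e2, deriv_const]
    ring

end finiteElements

/-! ### The global moment interpolant and its orthogonality -/

section interpolation
open Polynomial

variable {k s N : ℕ} {x : ℕ → ℝ}

theorem IsMomentInterpolant.exists_cell {v p : ℝ → ℝ} (hx : IsPartition N x)
    (h : IsMomentInterpolant k s N x v p) {i : ℕ} (hi : i < N) :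
    ∃ q : ℝ[X], IsCellInterpolant k s (x i) (x (i + 1) - x i) v q ∧
      ∀ t ∈ Icc (x i) (x (i + 1)), p t = q.eval t := by
  obtain ⟨q, hq, hpq⟩ := h.mem i hi
  have hle := (hx.lt_succ i hi).le
  refine ⟨q, ⟨hq, ?_, ?_, ?_⟩, hpq⟩
  · rw [← hpq _ (left_mem_Icc.2 hle), h.nodes i hi.le]
  · rw [add_sub_cancel, ← hpq _ (right_mem_Icc.2 hle), h.nodes (i + 1) hi]
  · intro l hl hlk
    rw [add_sub_cancel, ← h.moments i hi l hl hlk]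
    refine intervalIntegral.integral_congr_Ioo_of_le hle fun t ht => ?_
    simp only [hpq t (Ioo_subset_Icc_self ht)]

/-- Existence of the moment interpolant. -/
theorem exists_momentInterpolant (hk : 1 ≤ k) (s : ℕ) (hx : IsPartition N x) (v : ℝ → ℝ) :
    ∃ p : ℝ → ℝ, IsMomentInterpolant k s N x v p := by
  have hcell : ∀ i : ℕ, ∃ q : ℝ[X], i < N →
      IsCellInterpolant k s (x i) (x (i + 1) - x i) v q := by
    intro i
    by_cases hi : i < N
    · obtain ⟨q, h1, h2, h3, h4⟩ := exists_cell_interpolant hk s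
        (a := x i) (sub_pos.2 (hx.lt_succ i hi)) v
      exact ⟨q, fun _ => ⟨h1, h2, h3, h4⟩⟩
    · exact ⟨0, fun h => absurd h hi⟩
  choose q hq using hcell
  -- An interior mesh point lies in two cells and either may be chosen; outside $[0,1]$ the index is
  -- a dummy.
  have hidx : ∀ t : ℝ, ∃ j : ℕ, t ∈ unitI →
      j < N ∧ t ∈ Icc (x j) (x (j + 1)) := by
    intro t
    by_cases ht : t ∈ unitI
    · obtain ⟨j, hj, htj⟩ := hx.exists_cell ht
      exact ⟨j, fun _ => ⟨hj, htj⟩⟩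
    · exact ⟨0, fun h => absurd h ht⟩
  choose idx hidx using hidx
  have hL : ∀ i < N, (q i).eval (x i) = v (x i) := fun i hi => (hq i hi).left
  have hR : ∀ i < N, (q i).eval (x (i + 1)) = v (x (i + 1)) := fun i hi => by
    have := (hq i hi).right
    rwa [add_sub_cancel] at this
  -- Independence of the choice: where two cells meet, both polynomials take the value of $v$.
  have hglue : ∀ i < N, ∀ t ∈ Icc (x i) (x (i + 1)), (q (idx t)).eval t = (q i).eval t := by
    intro i hi t ht
    obtain ⟨hj, htj⟩ := hidx t (hx.cell_subset hi ht)
    rcases lt_trichotomy (idx t) i with h | h | h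
    · have h1 : x (idx t + 1) ≤ x i := hx.le_of_le h hi.le
      have e1 : t = x i := le_antisymm (htj.2.trans h1) ht.1
      have e2 : t = x (idx t + 1) := le_antisymm htj.2 (h1.trans ht.1)
      calc (q (idx t)).eval t = v t := by
            conv_lhs => arg 1; rw [e2]
            rw [hR _ hj, ← e2]
        _ = (q i).eval t := by rw [e1, hL i hi]
    · rw [h]
    · have h1 : x (i + 1) ≤ x (idx t) := hx.le_of_le h hj.le
      have e1 : t = x (i + 1) := le_antisymm ht.2 (h1.trans htj.1)
      have e2 : t = x (idx t) := le_antisymm (ht.2.trans h1) htj.1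
      calc (q (idx t)).eval t = v t := by
            conv_lhs => arg 1; rw [e2]
            rw [hL _ hj, ← e2]
        _ = (q i).eval t := by rw [e1, hR i hi]
  refine ⟨fun t => (q (idx t)).eval t, fun i hi => ⟨q i, (hq i hi).natDegree_le, hglue i hi⟩,
    ?_, ?_⟩
  · intro i hi
    rcases hi.eq_or_lt with rfl | hi
    · obtain ⟨j, rfl⟩ : ∃ j, i = j + 1 := by
        refine ⟨i - 1, (Nat.sub_add_cancel ?_).symm⟩
        by_contra! h0
        have h1 := hx.right
        rw [Nat.lt_one_iff.1 h0, hx.left] at h1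
        norm_num at h1
      have h := hglue j (by omega) (x (j + 1))
        (right_mem_Icc.2 (hx.lt_succ j (by omega)).le)
      exact h.trans (hR j (by omega))
    · exact (hglue i hi (x i) (left_mem_Icc.2 (hx.lt_succ i hi).le)).trans (hL i hi)
  · intro i hi l hl hlk
    have h := (hq i hi).moments l hl hlk
    rw [add_sub_cancel] at h
    rw [← h]
    refine intervalIntegral.integral_congr_Ioo_of_le (hx.lt_succ i hi).le fun t ht => ?_
    simp only [hglue i hi t (Ioo_subset_Icc_self ht)]

/-- Uniqueness of the moment interpolant. -/
theorem IsMomentInterpolant.eqOn (hx : IsPartition N x) {v p p' : ℝ → ℝ}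
    (h : IsMomentInterpolant k s N x v p) (h' : IsMomentInterpolant k s N x v p') :
    EqOn p p' unitI := by
  intro t ht
  obtain ⟨i, hi, hti⟩ := hx.exists_cell ht
  obtain ⟨q, hq, hpq⟩ := h.exists_cell hx hi
  obtain ⟨q', hq', hpq'⟩ := h'.exists_cell hx hi
  obtain ⟨K, -, hK⟩ := exists_interpolant_stability k s
  have hcell : IsCellInterpolant k s (x i) (x (i + 1) - x i) (fun t => q'.eval t) q :=
    ⟨hq.natDegree_le, hq.left.trans hq'.left.symm, hq.right.trans hq'.right.symm,
      fun l hl hlk => (hq.moments l hl hlk).trans (hq'.moments l hl hlk).symm⟩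
  -- The polynomial $q$ interpolates the polynomial $q'$, so stability applies with approximation
  -- error 0.
  have := (hK (x i) (x (i + 1) - x i) 0 (fun t => q'.eval t) q q'
    (sub_pos.2 (hx.lt_succ i hi)) q'.continuous.continuousOn hcell hq'.natDegree_le
    (fun _ _ => by simp) t (by rwa [add_sub_cancel])).1
  rw [mul_zero] at this
  rw [hpq t hti, hpq' t hti]
  exact sub_eq_zero.1 (abs_nonpos_iff.1 this)

/-- If the moments `0, …, k - 2` are preserved, then the derivative of the interpolation error
is orthogonal to the derivatives of the finite element functions. -/
theorem IsMomentInterpolant.integral_deriv_mul_deriv (hx : IsPartition N x) {v p φ : ℝ → ℝ}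
    (hv : PiecewiseC1 N x v) (h : IsMomentInterpolant k 0 N x v p) (hφ : IsFE k N x φ) :
    ∫ t in (0 : ℝ)..1, deriv (fun t => p t - v t) t * deriv φ t = 0 := by
  have hp := h.mem.piecewiseC1
  have he := hp.sub hv
  have hpc := (he.deriv hx).mul (hφ.piecewiseC1.deriv hx)
  rw [hpc.integral_eq_sum hx]
  refine Finset.sum_eq_zero fun i hi => ?_
  rw [Finset.mem_range] at hi
  have hle := (hx.lt_succ i hi).le
  obtain ⟨q, hq, hqφ⟩ := hφ i hi
  have hvi : ContinuousOn v (Icc (x i) (x (i + 1))) := (hv i hi).continuousOn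
  have hpi : ContinuousOn p (Icc (x i) (x (i + 1))) := (hp i hi).continuousOn
  have hei : ContinuousOn (fun t => p t - v t) (Icc (x i) (x (i + 1))) := hpi.sub hvi
  have hφ' : ∀ t ∈ Ioo (x i) (x (i + 1)), deriv φ t = q.derivative.eval t := by
    intro t ht
    have : φ =ᶠ[nhds t] fun y => q.eval y :=
      Filter.eventuallyEq_of_mem (Icc_mem_nhds ht.1 ht.2) hqφ
    rw [this.deriv_eq, Polynomial.deriv]
  -- For $k=1$ no `natDegree` is below $k-1=0$, although the zero polynomial must be admitted; hence
  -- the second alternative.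
  have hmom : ∀ r : ℝ[X], r.natDegree < k - 1 ∨ r = 0 →
      ∫ t in (x i)..(x (i + 1)), (p t - v t) * r.eval t = 0 := by
    rintro r (hr | rfl)
    -- Expansion about the left end of the cell, because the preserved moments have weights
    -- $(t-x_i)^l$.
    · have hexp : ∀ t : ℝ, r.eval t
          = ∑ l ∈ Finset.range (k - 1), (taylor (x i) r).coeff l * (t - x i) ^ l := by
        intro t
        rw [← eval_eq_sum_range' (by rwa [natDegree_taylor]), taylor_eval]
        simp
      have hint : ∀ l, IntervalIntegrable (fun t => (t - x i) ^ l * (p t - v t))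
          MeasureTheory.volume (x i) (x (i + 1)) := fun l => by
        apply ContinuousOn.intervalIntegrable
        rw [uIcc_of_le hle]
        exact (by fun_prop : Continuous fun t : ℝ => (t - x i) ^ l).continuousOn.mul hei
      have e : (fun t => (p t - v t) * r.eval t) = fun t => ∑ l ∈ Finset.range (k - 1),
          (taylor (x i) r).coeff l * ((t - x i) ^ l * (p t - v t)) := by
        funext t
        rw [hexp, Finset.mul_sum]
        refine Finset.sum_congr rfl fun l _ => ?_
        ring
      rw [e, intervalIntegral.integral_finsetSum fun l _ => (hint l).const_mul _]
      refine Finset.sum_eq_zero fun l hl => ?_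
      rw [Finset.mem_range] at hl
      rw [intervalIntegral.integral_const_mul]
      have i1 : IntervalIntegrable (fun t => (t - x i) ^ l * p t)
          MeasureTheory.volume (x i) (x (i + 1)) := by
        apply ContinuousOn.intervalIntegrable
        rw [uIcc_of_le hle]
        exact (by fun_prop : Continuous fun t : ℝ => (t - x i) ^ l).continuousOn.mul hpi
      have i2 : IntervalIntegrable (fun t => (t - x i) ^ l * v t)
          MeasureTheory.volume (x i) (x (i + 1)) := by
        apply ContinuousOn.intervalIntegrable
        rw [uIcc_of_le hle]
        exact (by fun_prop : Continuous fun t : ℝ => (t - x i) ^ l).continuousOn.mul hvi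
      simp only [mul_sub]
      rw [intervalIntegral.integral_sub i1 i2, h.moments i hi l (Nat.zero_le _) (by omega),
        sub_self, mul_zero]
    · simp
  have hzero : ∫ t in (x i)..(x (i + 1)), (p t - v t) * q.derivative.derivative.eval t = 0 := by
    refine hmom _ ?_
    by_cases hz : q.derivative.derivative = 0
    · exact Or.inr hz
    · left
      have h1 : q.derivative.natDegree ≠ 0 := fun h0 => hz (by
        rw [eq_C_of_natDegree_eq_zero h0, derivative_C])
      have h2 := natDegree_derivative_lt h1
      have h3 := natDegree_derivative_le q
      omega
  have ideriv : IntervalIntegrable (fun t => deriv (fun t => p t - v t) t * q.derivative.eval t)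
      MeasureTheory.volume (x i) (x (i + 1)) :=
    ((he.deriv hx).intervalIntegrable_cell hx hi).mul_continuousOn
      q.derivative.continuous.continuousOn
  have isecond : IntervalIntegrable (fun t => (p t - v t) * q.derivative.derivative.eval t)
      MeasureTheory.volume (x i) (x (i + 1)) := by
    apply ContinuousOn.intervalIntegrable
    rw [uIcc_of_le hle]
    exact hei.mul q.derivative.derivative.continuous.continuousOn
  -- Integration by parts on the cell: the boundary terms vanish at the mesh points, and the
  -- remaining integral against $q''$ is a combination of preserved moments.
  have hftc := intervalIntegral.integral_eq_sub_of_hasDerivAt_of_le hle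
    (f := fun t => (p t - v t) * q.derivative.eval t)
    (hei.mul q.derivative.continuous.continuousOn)
    (fun t ht => (he.differentiableAt ⟨i, hi, ht⟩).hasDerivAt.mul (q.derivative.hasDerivAt t))
    (ideriv.add isecond)
  rw [intervalIntegral.integral_add ideriv isecond, hzero, add_zero, h.nodes i hi.le,
    h.nodes (i + 1) hi] at hftc
  rw [intervalIntegral.integral_congr_Ioo_of_le hle
    (g := fun t => deriv (fun t => p t - v t) t * q.derivative.eval t)
    (fun t ht => by simp only [hφ' t ht]), hftc]
  ring

end interpolation

/-! ### The layer-adapted mesh and the weight it balances -/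

section layerMesh

variable {k n m : ℕ} {ε α H h : ℝ}

theorem meshPoint_of_le {τ H h : ℝ} {n m i : ℕ} (hi : i ≤ n) :
    meshPoint τ H h n m i = i * h := if_pos hi

/-- The branches of the definition agree at the joint $i=n$. Thus both ends of a coarse cell are
given by the same formula. -/
theorem meshPoint_middle {τ H h : ℝ} {n m i : ℕ} (hτ : n * h = τ) (h1 : n ≤ i) (h2 : i ≤ n + m) :
    meshPoint τ H h n m i = τ + ((i : ℝ) - n) * H := by
  unfold meshPoint
  split_ifs with h3
  · obtain rfl : i = n := le_antisymm h3 h1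
    rw [hτ, sub_self, zero_mul, add_zero]
  · rfl

theorem meshPoint_right {τ H h : ℝ} {n m i : ℕ} (hτ : n * h = τ) (hm : m * H = 1 - 2 * τ)
    (h1 : n + m ≤ i) : meshPoint τ H h n m i = 1 - τ + ((i : ℝ) - n - m) * h := by
  rcases h1.eq_or_lt with rfl | h2
  · rw [meshPoint_middle hτ (by omega) le_rfl]
    push_cast
    linarith
  · unfold meshPoint
    rw [if_neg (by omega), if_neg (by omega)]

theorem IsLayerMesh.transitionPoint_lt (hM : IsLayerMesh k ε α H h n m) :
    transitionPoint k ε < 1 / 2 := by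
  have h1 : (0 : ℝ) < m * H := mul_pos (by exact_mod_cast hM.m_pos) hM.H_pos
  have h2 := hM.coarse_cells
  linarith

theorem transitionPoint_pos (k : ℕ) (hε : 0 < ε) : 0 < transitionPoint k ε :=
  Real.rpow_pos_of_pos hε _

/-- The exponent in $\tau$ is made for this: $1+2k(1-\tfrac1{2k})=2k$. It converts
$\tau^{2k}\varepsilon^{-2k}$ into $\varepsilon^{-1}$, and $(\tau/\varepsilon)^{2k}$ into
$\varepsilon^{-1}$ as well. -/
theorem transitionPoint_pow (hk : 1 ≤ k) (hε : 0 < ε) :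
    ε * transitionPoint k ε ^ (2 * k) = ε ^ (2 * k) := by
  have hk0 : (k : ℝ) ≠ 0 := by
    have : (1 : ℝ) ≤ k := by exact_mod_cast hk
    linarith
  rw [transitionPoint, ← Real.rpow_natCast, ← Real.rpow_mul hε.le, ← Real.rpow_natCast ε]
  nth_rewrite 1 [← Real.rpow_one ε]
  rw [← Real.rpow_add hε]
  congr 1
  push_cast
  field_simp
  ring

/-- For $\varepsilon\ge1$ the transition point would be at least 1, leaving no room for a coarse
cell. -/
theorem IsLayerMesh.eps_lt_one (hk : 1 ≤ k) (hM : IsLayerMesh k ε α H h n m) : ε < 1 := by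
  by_contra! h1
  have hk1 : (1 : ℝ) ≤ k := by exact_mod_cast hk
  have h2 : 1 ≤ transitionPoint k ε := by
    apply Real.one_le_rpow h1
    rw [sub_nonneg, div_le_one (by positivity)]
    linarith
  have := hM.transitionPoint_lt
  linarith

theorem IsLayerMesh.h_pos (hε : 0 < ε) (hM : IsLayerMesh k ε α H h n m) : 0 < h := by
  have h1 := hM.fine_cells
  have h2 := transitionPoint_pos k hε
  rw [← h1] at h2
  exact pos_of_mul_pos_right h2 (Nat.cast_nonneg n)

theorem IsLayerMesh.alpha_pos (hε : 0 < ε) (hM : IsLayerMesh k ε α H h n m) : 0 < α := by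
  have h1 := hM.h_pos hε
  rw [hM.fine_size] at h1
  exact pos_of_mul_pos_left (pos_of_mul_pos_left h1 (transitionPoint_pos k hε).le) hM.H_pos.le

/-- Every cell is either of length `h`, or of length `H` and contained in `[τ, 1 - τ]`. -/
theorem IsLayerMesh.cell_cases (hM : IsLayerMesh k ε α H h n m) {i : ℕ} {x : ℕ → ℝ}
    (hx : x = meshPoint (transitionPoint k ε) H h n m) :
    x (i + 1) - x i = h ∨
      (x (i + 1) - x i = H ∧ transitionPoint k ε ≤ x i ∧ x (i + 1) ≤ 1 - transitionPoint k ε) := by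
  have hτ := hM.fine_cells
  have hm := hM.coarse_cells
  subst hx
  rcases Nat.lt_or_ge i n with h1 | h1
  · left
    rw [meshPoint_of_le (by omega), meshPoint_of_le h1.le]
    push_cast
    ring
  rcases Nat.lt_or_ge i (n + m) with h2 | h2
  · right
    have h3 : (n : ℝ) ≤ i := by exact_mod_cast h1
    have h4 : (i : ℝ) + 1 ≤ n + m := by exact_mod_cast h2
    have hH := hM.H_pos
    rw [meshPoint_middle hτ h1 h2.le, meshPoint_middle hτ (by omega) (by omega)]
    push_cast
    refine ⟨by ring, by nlinarith, by nlinarith⟩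
  · left
    rw [meshPoint_right hτ hm h2, meshPoint_right hτ hm (by omega)]
    push_cast
    ring

theorem IsLayerMesh.isPartition (hε : 0 < ε) (hM : IsLayerMesh k ε α H h n m) :
    IsPartition (2 * n + m) (meshPoint (transitionPoint k ε) H h n m) where
  left := by
    rw [meshPoint_of_le (Nat.zero_le n)]
    simp
  right := by
    rw [meshPoint_right hM.fine_cells hM.coarse_cells (by omega)]
    push_cast
    linarith [hM.fine_cells]
  lt_succ i _ := by
    have h1 := hM.h_pos hε
    have h2 := hM.H_pos
    rcases hM.cell_cases (i := i) rfl with h3 | ⟨h3, -⟩ <;> linarith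

/-- The size of the layer functions in the mean-square sense. -/
noncomputable def layerWeight (ε t : ℝ) : ℝ :=
  1 + ε⁻¹ * (Real.exp (-t / ε) ^ 2 + Real.exp (-(1 - t) / ε) ^ 2)

theorem continuous_layerWeight (ε : ℝ) : Continuous (layerWeight ε) := by
  unfold layerWeight
  fun_prop

/-- The integral is exactly $2-e^{-2/\varepsilon}$: integrating a squared layer exponential gains
the factor $\varepsilon$ that $\varepsilon^{-1}$ costs. -/
theorem integral_layerWeight_le (hε : 0 < ε) : ∫ t in (0 : ℝ)..1, layerWeight ε t ≤ 2 := by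
  have hder : ∀ t : ℝ, HasDerivAt (fun t => t - Real.exp (-t / ε) ^ 2 / 2
      + Real.exp (-(1 - t) / ε) ^ 2 / 2) (layerWeight ε t) t := by
    intro t
    have h1 : HasDerivAt (fun t : ℝ => -t / ε) (-1 / ε) t := (hasDerivAt_id t).neg.div_const ε
    have h2 : HasDerivAt (fun t : ℝ => -(1 - t) / ε) (1 / ε) t := by
      have := ((hasDerivAt_id t).const_sub 1).neg.div_const ε
      simpa using this
    refine (((hasDerivAt_id t).sub ((h1.exp.pow 2).div_const 2)).add
      ((h2.exp.pow 2).div_const 2)).congr_deriv ?_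
    unfold layerWeight
    field_simp
    ring
  rw [intervalIntegral.integral_eq_sub_of_hasDerivAt (fun t _ => hder t)
    ((continuous_layerWeight ε).intervalIntegrable _ _)]
  have e1 : Real.exp (-(1 : ℝ) / ε) ≤ 1 := Real.exp_le_one_iff.2
    (div_nonpos_of_nonpos_of_nonneg (by norm_num) hε.le)
  have e0 := Real.exp_pos (-(1 : ℝ) / ε)
  norm_num
  nlinarith

/-- In `[τ, 1 - τ]` the layer functions are smaller than every power of `ε`. -/
theorem inv_pow_mul_exp_le (hk : 1 ≤ k) (hε : 0 < ε) {t : ℝ} (ht : transitionPoint k ε ≤ t) :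
    (ε ^ k)⁻¹ * Real.exp (-t / ε) ≤ (2 * k * k).factorial := by
  set τ := transitionPoint k ε with hτ
  have hτ0 : 0 < τ := transitionPoint_pos k hε
  have hy : 0 < τ / ε := div_pos hτ0 hε
  have hp : (τ / ε) ^ (2 * k) = ε⁻¹ := by
    rw [div_pow, ← transitionPoint_pow hk hε, ← hτ]
    field_simp
  -- With $y=\tau/\varepsilon$ one has $\varepsilon^{-k}=y^{2k^2}$, and $y^n/n!\le e^y$ for $n=2k^2$
  -- gives the factorial.
  have hpow : (ε ^ k)⁻¹ = (τ / ε) ^ (2 * k * k) := by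
    rw [pow_mul, hp, inv_pow]
  have hexp := Real.pow_div_factorial_le_exp _ hy.le (2 * k * k)
  rw [div_le_iff₀ (by positivity)] at hexp
  have hmono : Real.exp (-t / ε) ≤ Real.exp (-(τ / ε)) := by
    apply Real.exp_le_exp.2
    rw [neg_div]
    exact neg_le_neg (div_le_div_of_nonneg_right ht hε.le)
  rw [hpow]
  calc (τ / ε) ^ (2 * k * k) * Real.exp (-t / ε)
      ≤ (Real.exp (τ / ε) * (2 * k * k).factorial) * Real.exp (-(τ / ε)) :=
        mul_le_mul hexp hmono (Real.exp_pos _).le (by positivity)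
    _ = (2 * k * k).factorial := by
        rw [Real.exp_neg]
        field_simp

/-- The cell size weighs the layer functions down to order `H`. -/
theorem IsLayerMesh.weight_le (hk : 1 ≤ k) (hε : 0 < ε) (hM : IsLayerMesh k ε α H h n m)
    {α₁ C₀ : ℝ} (hα : α ≤ α₁) {x : ℕ → ℝ}
    (hx : x = meshPoint (transitionPoint k ε) H h n m) {g : ℝ → ℝ}
    (hg : ∀ t ∈ unitI, |g t| ≤ C₀ * (1 + (ε ^ k)⁻¹ *
      (Real.exp (-t / ε) + Real.exp (-(1 - t) / ε)))) {i : ℕ} (hi : i < 2 * n + m) {t : ℝ}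
    (ht : t ∈ Ioo (x i) (x (i + 1))) :
    (x (i + 1) - x i) ^ (2 * k) * g t ^ 2 ≤
      (C₀ ^ 2 * (3 * α₁ ^ (2 * k) + (1 + 2 * ((2 * k * k).factorial : ℝ)) ^ 2) * H ^ (2 * k))
        * layerWeight ε t := by
  have hpart := hM.isPartition hε
  rw [← hx] at hpart
  have htI : t ∈ unitI := hpart.cell_subset hi (Ioo_subset_Icc_self ht)
  set F : ℝ := ((2 * k * k).factorial : ℝ) with hF
  set E₁ := Real.exp (-t / ε) with hE₁
  set E₂ := Real.exp (-(1 - t) / ε) with hE₂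
  have hE₁0 : 0 < E₁ := Real.exp_pos _
  have hE₂0 : 0 < E₂ := Real.exp_pos _
  have hW : layerWeight ε t = 1 + ε⁻¹ * (E₁ ^ 2 + E₂ ^ 2) := rfl
  have hW1 : 1 ≤ layerWeight ε t := by
    rw [hW]
    have : 0 ≤ ε⁻¹ * (E₁ ^ 2 + E₂ ^ 2) := by positivity
    linarith
  have hgsq : g t ^ 2 ≤ C₀ ^ 2 * (1 + (ε ^ k)⁻¹ * (E₁ + E₂)) ^ 2 := by
    rw [← sq_abs, ← mul_pow]
    exact pow_le_pow_left₀ (abs_nonneg _) (hg t htI) 2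
  have hα0 := hM.alpha_pos hε
  have hH := hM.H_pos
  have hF0 : 0 < F := by positivity
  have hα₁ : 0 < α₁ := hα0.trans_le hα
  rcases hM.cell_cases (i := i) hx with hl | ⟨hl, h1, h2⟩
  · have hτ0 := transitionPoint_pos k hε
    have hτ1 : transitionPoint k ε ^ (2 * k) ≤ 1 :=
      pow_le_one₀ hτ0.le (by linarith [hM.transitionPoint_lt])
    have hτp := transitionPoint_pow hk hε
    have hh : h = α * H * transitionPoint k ε := hM.fine_size
    set τ := transitionPoint k ε
    -- Fine cell: the factor $\tau^{2k}$ in $h^{2k}$ reduces $\varepsilon^{-2k}$ to the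
    -- $\varepsilon^{-1}$ of `layerWeight`.
    have hscale : τ ^ (2 * k) * ((ε ^ k)⁻¹) ^ 2 = ε⁻¹ := by
      rw [inv_pow, ← pow_mul, mul_comm k 2, ← hτp]
      field_simp
    have hmain : τ ^ (2 * k) * (1 + (ε ^ k)⁻¹ * (E₁ + E₂)) ^ 2 ≤ 3 * layerWeight ε t := by
      have h3 : (1 + (ε ^ k)⁻¹ * (E₁ + E₂)) ^ 2
          ≤ 3 * (1 + ((ε ^ k)⁻¹) ^ 2 * (E₁ ^ 2 + E₂ ^ 2)) := by
        nlinarith [sq_nonneg (1 - (ε ^ k)⁻¹ * E₁), sq_nonneg (1 - (ε ^ k)⁻¹ * E₂),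
          sq_nonneg ((ε ^ k)⁻¹ * E₁ - (ε ^ k)⁻¹ * E₂)]
      calc τ ^ (2 * k) * (1 + (ε ^ k)⁻¹ * (E₁ + E₂)) ^ 2
          ≤ τ ^ (2 * k) * (3 * (1 + ((ε ^ k)⁻¹) ^ 2 * (E₁ ^ 2 + E₂ ^ 2))) :=
            mul_le_mul_of_nonneg_left h3 (by positivity)
        _ = 3 * (τ ^ (2 * k) + (τ ^ (2 * k) * ((ε ^ k)⁻¹) ^ 2) * (E₁ ^ 2 + E₂ ^ 2)) := by ring
        _ ≤ 3 * layerWeight ε t := by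
            rw [hscale, hW]
            linarith
    have hαp : α ^ (2 * k) ≤ α₁ ^ (2 * k) := pow_le_pow_left₀ hα0.le hα _
    rw [hl, hh]
    calc (α * H * τ) ^ (2 * k) * g t ^ 2
        ≤ (α * H * τ) ^ (2 * k) * (C₀ ^ 2 * (1 + (ε ^ k)⁻¹ * (E₁ + E₂)) ^ 2) :=
          mul_le_mul_of_nonneg_left hgsq (by positivity)
      _ = C₀ ^ 2 * H ^ (2 * k) * α ^ (2 * k)
            * (τ ^ (2 * k) * (1 + (ε ^ k)⁻¹ * (E₁ + E₂)) ^ 2) := by ring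
      _ ≤ C₀ ^ 2 * H ^ (2 * k) * α₁ ^ (2 * k) * (3 * layerWeight ε t) := by gcongr
      _ ≤ _ := by
          have : 0 ≤ C₀ ^ 2 * H ^ (2 * k) * (1 + 2 * F) ^ 2 * layerWeight ε t := by positivity
          linarith
  -- Coarse cell: the point is at distance at least $\tau$ from both ends, so each layer term is at
  -- most $F$ even with $\varepsilon^{-k}$ in front.
  · have b1 : (ε ^ k)⁻¹ * E₁ ≤ F := inv_pow_mul_exp_le hk hε (h1.trans ht.1.le)
    have b2 : (ε ^ k)⁻¹ * E₂ ≤ F := inv_pow_mul_exp_le hk hε (by linarith [ht.2])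
    have hmain : (1 + (ε ^ k)⁻¹ * (E₁ + E₂)) ^ 2 ≤ (1 + 2 * F) ^ 2 :=
      pow_le_pow_left₀ (by positivity) (by linarith) 2
    rw [hl]
    calc H ^ (2 * k) * g t ^ 2
        ≤ H ^ (2 * k) * (C₀ ^ 2 * (1 + 2 * F) ^ 2) :=
          mul_le_mul_of_nonneg_left (hgsq.trans
            (mul_le_mul_of_nonneg_left hmain (sq_nonneg _))) (by positivity)
      _ ≤ (C₀ ^ 2 * (3 * α₁ ^ (2 * k) + (1 + 2 * F) ^ 2) * H ^ (2 * k)) * 1 := by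
          have : 0 ≤ C₀ ^ 2 * (3 * α₁ ^ (2 * k)) * H ^ (2 * k) := by positivity
          linarith
      _ ≤ _ := mul_le_mul_of_nonneg_left hW1 (by positivity)

end layerMesh

/-! ### Derivative bounds from the decomposition and global interpolation errors -/

section layerBounds

variable {k : ℕ} {ε C₀ : ℝ} {u S E₁ E₂ : ℝ → ℝ}

/-- The order $k+2$ exceeds the four derivatives of a classical solution when $k>2$; the extra
regularity comes from the decomposition. -/
theorem IsLayerDecomposition.contDiffOn {r : ℕ}
    (hdec : IsLayerDecomposition r C₀ ε u S E₁ E₂) : ContDiffOn ℝ r u unitI :=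
  ((hdec.smooth_S.add hdec.smooth_E₁).add hdec.smooth_E₂).congr hdec.sum_eq

theorem IsLayerDecomposition.derivI_eq {r : ℕ} (hdec : IsLayerDecomposition r C₀ ε u S E₁ E₂)
    {j : ℕ} (hj : j ≤ r) {t : ℝ} (ht : t ∈ unitI) :
    derivI j u t = derivI j S t + derivI j E₁ t + derivI j E₂ t := by
  have hjr : (j : WithTop ℕ∞) ≤ (r : WithTop ℕ∞) := by exact_mod_cast hj
  have h1 : EqOn u (S + E₁ + E₂) unitI := hdec.sum_eq
  have e := iteratedDerivWithin_congr (n := j) h1 ht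
  have hS := (hdec.smooth_S t ht).of_le hjr
  have hE₁ := (hdec.smooth_E₁ t ht).of_le hjr
  have hE₂ := (hdec.smooth_E₂ t ht).of_le hjr
  have hSE : ContDiffWithinAt ℝ j (S + E₁) unitI t := hS.add hE₁
  rw [derivI, e, iteratedDerivWithin_add ht uniqueDiffOn_unitI hSE hE₂,
    iteratedDerivWithin_add ht uniqueDiffOn_unitI hS hE₁]

theorem IsLayerDecomposition.abs_derivI_le {r : ℕ}
    (hdec : IsLayerDecomposition r C₀ ε u S E₁ E₂) {j : ℕ} (hj : j ≤ r) {t : ℝ}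
    (ht : t ∈ unitI) : |derivI j u t| ≤ C₀ * (1 + ε ^ (1 - (j : ℤ)) *
      (Real.exp (-t / ε) + Real.exp (-(1 - t) / ε))) := by
  rw [hdec.derivI_eq hj ht]
  have h1 := hdec.bound_S j hj t ht
  have h2 := hdec.bound_E₁ j hj t ht
  have h3 := hdec.bound_E₂ j hj t ht
  have h4 := abs_add_three (derivI j S t) (derivI j E₁ t) (derivI j E₂ t)
  linarith

theorem IsLayerDecomposition.abs_derivI_succ_le
    (hdec : IsLayerDecomposition (k + 2) C₀ ε u S E₁ E₂) {t : ℝ} (ht : t ∈ unitI) :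
    |derivI (k + 1) u t| ≤ C₀ * (1 + (ε ^ k)⁻¹ *
      (Real.exp (-t / ε) + Real.exp (-(1 - t) / ε))) := by
  have h := hdec.abs_derivI_le (j := k + 1) (by omega) ht
  have e : ε ^ (1 - ((k + 1 : ℕ) : ℤ)) = (ε ^ k)⁻¹ := by
    rw [show (1 - ((k + 1 : ℕ) : ℤ)) = -(k : ℤ) by push_cast; ring, zpow_neg, zpow_natCast]
  rwa [e] at h

/-- The factor $\varepsilon$ compensates the one additional derivative of the layer parts; in the
smooth part it is absorbed by $\varepsilon<1$ and $C_0\ge0$. Thus $w$ obeys the same bound as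
$u^{(k+1)}$. -/
theorem IsLayerDecomposition.abs_mul_derivI_le (hε : 0 < ε) (hε1 : ε < 1)
    (hdec : IsLayerDecomposition (k + 2) C₀ ε u S E₁ E₂) {t : ℝ} (ht : t ∈ unitI) :
    |ε * derivI (k + 2) u t| ≤ C₀ * (1 + (ε ^ k)⁻¹ *
      (Real.exp (-t / ε) + Real.exp (-(1 - t) / ε))) := by
  have h := hdec.abs_derivI_le (j := k + 2) le_rfl ht
  have hC : 0 ≤ C₀ := (abs_nonneg _).trans (hdec.bound_S 0 (by omega) t ht)
  have e : ε * ε ^ (1 - ((k + 2 : ℕ) : ℤ)) = (ε ^ k)⁻¹ := by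
    rw [← zpow_one_add₀ hε.ne', show (1 + (1 - ((k + 2 : ℕ) : ℤ))) = -(k : ℤ) by
      push_cast; ring, zpow_neg, zpow_natCast]
  rw [abs_mul, abs_of_pos hε]
  calc ε * |derivI (k + 2) u t| ≤ ε * (C₀ * (1 + ε ^ (1 - ((k + 2 : ℕ) : ℤ)) *
      (Real.exp (-t / ε) + Real.exp (-(1 - t) / ε)))) := mul_le_mul_of_nonneg_left h hε.le
    _ = C₀ * ε + C₀ * ((ε * ε ^ (1 - ((k + 2 : ℕ) : ℤ))) *
      (Real.exp (-t / ε) + Real.exp (-(1 - t) / ε))) := by ring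
    _ ≤ _ := by
      rw [e]
      nlinarith

/-- The interpolation errors on the layer-adapted mesh, in the mean-square sense. -/
theorem exists_layer_interpolation_error (k s : ℕ) (hk : 1 ≤ k) (α₁ C₀ : ℝ) :
    ∃ K : ℝ, 0 ≤ K ∧ ∀ (ε : ℝ) (u S E₁ E₂ : ℝ → ℝ), 0 < ε →
      ContDiffOn ℝ 4 u unitI → IsLayerDecomposition (k + 2) C₀ ε u S E₁ E₂ →
      ∀ (α H h : ℝ) (n m : ℕ), α ≤ α₁ → IsLayerMesh k ε α H h n m →
      ∀ (x : ℕ → ℝ) (pu pw : ℝ → ℝ), x = meshPoint (transitionPoint k ε) H h n m →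
      IsMomentInterpolant k s (2 * n + m) x u pu →
      IsMomentInterpolant k s (2 * n + m) x (fun t => ε * derivI 2 u t) pw →
      (∫ t in (0 : ℝ)..1, (pu t - u t) ^ 2) ≤ K * H ^ (2 * k) ∧
      (∫ t in (0 : ℝ)..1, deriv (fun t => pu t - u t) t ^ 2) ≤ K * H ^ (2 * k) ∧
      (∫ t in (0 : ℝ)..1, (pw t - ε * derivI 2 u t) ^ 2) ≤ K * H ^ (2 * k) := by
  obtain ⟨K₁, hK₁, herr₁⟩ := exists_interpolation_error k s hk
  obtain ⟨K₂, hK₂, herr₂⟩ := exists_interpolation_error_deriv k s hk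
  set A : ℝ := C₀ ^ 2 * (3 * α₁ ^ (2 * k) + (1 + 2 * ((2 * k * k).factorial : ℝ)) ^ 2) with hA
  -- The exponent is even, so the sign of $\alpha_1$ is irrelevant here.
  have hα₁ : 0 ≤ α₁ ^ (2 * k) := by
    rw [pow_mul]
    positivity
  have hA0 : 0 ≤ A := by positivity
  -- $A$ is the factor from `IsLayerMesh.weight_le`, and 2 bounds the integral of `layerWeight`.
  refine ⟨(K₁ ^ 2 + K₂ ^ 2) * (A * 2), by positivity, ?_⟩
  intro ε u S E₁ E₂ hε hu4 hdec α H h n m hα hM x pu pw hx hpu hpw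
  have hpart := hM.isPartition hε
  rw [← hx] at hpart
  have hε1 := hM.eps_lt_one hk
  have hu := hdec.contDiffOn
  have hH := hM.H_pos
  have hu1 : PiecewiseC1 (2 * n + m) x u := ContDiffOn.piecewiseC1 hpart (hu4.of_le (by norm_num))
  have hw1 : PiecewiseC1 (2 * n + m) x (fun t => ε * derivI 2 u t) :=
    (ContDiffOn.piecewiseC1 hpart
      (contDiffOn_derivI (r := 4) (by exact_mod_cast hu4) (by norm_num))).const_mul ε
  have heu := hpu.mem.piecewiseC1.sub hu1
  have hew := hpw.mem.piecewiseC1.sub hw1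
  have hint := integral_layerWeight_le hε
  have hint0 : 0 ≤ ∫ t in (0 : ℝ)..1, layerWeight ε t :=
    intervalIntegral.integral_nonneg zero_le_one fun t _ => by
      unfold layerWeight
      positivity
  have hcw := (continuous_layerWeight ε).continuousOn (s := unitI)
  have hg₁ : ContinuousOn (derivI (k + 1) u) unitI := continuousOn_derivI hu (by omega)
  have hg₂ : ContinuousOn (fun t => ε * derivI (k + 2) u t) unitI :=
    continuousOn_const.mul (continuousOn_derivI hu le_rfl)
  have hcell : ∀ i < 2 * n + m, x i + (x (i + 1) - x i) = x (i + 1) := fun i _ => by ring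
  have bound₂ : ∀ i < 2 * n + m, ∀ t ∈ Ioo (x i) (x (i + 1)),
      |pu t - u t| ≤ K₂ * (x (i + 1) - x i) ^ (k - 1)
          * ∫ y in (x i)..(x (i + 1)), |derivI (k + 1) u y| ∧
      |deriv (fun t => pu t - u t) t| ≤ K₂ * (x (i + 1) - x i) ^ (k - 1)
          * ∫ y in (x i)..(x (i + 1)), |derivI (k + 1) u y| := by
    intro i hi t ht
    obtain ⟨q, hq, hpq⟩ := hpu.exists_cell hpart hi
    have hlt := hpart.lt_succ i hi
    have hsub := hpart.cell_subset hi
    have hsubo := hpart.open_cell_subset hi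
    have hb := herr₂ (x i) (x (i + 1) - x i) (fun j => derivI j u) q (by linarith)
      (fun j hj => by
        rw [hcell i hi]
        exact (continuousOn_derivI hu (by omega)).mono hsub)
      (fun j hj y hy => by
        rw [hcell i hi] at hy
        exact hasDerivAt_derivI hu (by omega) (hsubo hy))
      (by simpa only [derivI_zero] using hq) t
      (by rw [hcell i hi]; exact Ioo_subset_Icc_self ht)
    rw [hcell i hi, derivI_zero, ← hpq t (Ioo_subset_Icc_self ht)] at hb
    obtain ⟨hb1, hb2⟩ := hb
    constructor
    -- The value error carries an additional cell length, which is at most 1 and is given away.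
    · refine hb1.trans (mul_le_of_le_one_left ((abs_nonneg _).trans hb2) ?_)
      linarith [hpart.nonneg hi.le, hpart.le_one hi]
    · have e1 : deriv (fun t => pu t - u t) t = q.derivative.eval t - derivI 1 u t := by
        rw [hpu.mem.piecewiseC1.deriv_sub hu1 ⟨i, hi, ht⟩]
        have e2 : pu =ᶠ[nhds t] fun y => q.eval y :=
          Filter.eventuallyEq_of_mem (Icc_mem_nhds ht.1 ht.2) hpq
        have e3 := hasDerivAt_derivI hu (j := 0) (by omega) (hsubo ht)
        rw [derivI_zero] at e3
        simp only [e2.deriv_eq, Polynomial.deriv, e3.deriv, zero_add]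
      rw [e1]
      exact hb2
  have bound₁ : ∀ i < 2 * n + m, ∀ t ∈ Ioo (x i) (x (i + 1)),
      |pw t - ε * derivI 2 u t| ≤ K₁ * (x (i + 1) - x i) ^ (k - 1)
          * ∫ y in (x i)..(x (i + 1)), |ε * derivI (k + 2) u y| := by
    intro i hi t ht
    obtain ⟨q, hq, hpq⟩ := hpw.exists_cell hpart hi
    have hlt := hpart.lt_succ i hi
    have hsub := hpart.cell_subset hi
    have hsubo := hpart.open_cell_subset hi
    have hb := herr₁ (x i) (x (i + 1) - x i) (fun j t => ε * derivI (j + 2) u t) q (by linarith)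
      (fun j hj => by
        rw [hcell i hi]
        exact continuousOn_const.mul ((continuousOn_derivI hu (by omega)).mono hsub))
      (fun j hj y hy => by
        rw [hcell i hi] at hy
        have := (hasDerivAt_derivI hu (j := j + 2) (by omega) (hsubo hy)).const_mul ε
        rwa [show j + 2 + 1 = j + 1 + 2 by ring] at this)
      hq t (by rw [hcell i hi]; exact Ioo_subset_Icc_self ht)
    rwa [hcell i hi, ← hpq t (Ioo_subset_Icc_self ht)] at hb
  have weight₁ := fun i (hi : i < 2 * n + m) t (ht : t ∈ Ioo (x i) (x (i + 1))) =>
    hM.weight_le hk hε hα hx (fun t ht => hdec.abs_derivI_succ_le ht) hi ht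
  have weight₂ := fun i (hi : i < 2 * n + m) t (ht : t ∈ Ioo (x i) (x (i + 1))) =>
    hM.weight_le hk hε hα hx (g := fun t => ε * derivI (k + 2) u t)
      (fun t ht => hdec.abs_mul_derivI_le hε hε1 ht) hi ht
  have hfin : ∀ κ : ℝ, κ ^ 2 ≤ K₁ ^ 2 + K₂ ^ 2 →
      κ ^ 2 * (A * H ^ (2 * k) * ∫ t in (0 : ℝ)..1, layerWeight ε t)
        ≤ (K₁ ^ 2 + K₂ ^ 2) * (A * 2) * H ^ (2 * k) := by
    intro κ hκ
    have h1 : A * H ^ (2 * k) * (∫ t in (0 : ℝ)..1, layerWeight ε t) ≤ A * H ^ (2 * k) * 2 :=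
      mul_le_mul_of_nonneg_left hint (by positivity)
    calc κ ^ 2 * (A * H ^ (2 * k) * ∫ t in (0 : ℝ)..1, layerWeight ε t)
        ≤ (K₁ ^ 2 + K₂ ^ 2) * (A * H ^ (2 * k) * 2) :=
          mul_le_mul hκ h1 (by positivity) (by positivity)
      _ = _ := by ring
  refine ⟨?_, ?_, ?_⟩
  · exact (integral_sq_le_of_cell_bound hpart hk heu.piecewiseCont hg₁ hcw
      (fun i hi t ht => (bound₂ i hi t ht).1) weight₁).trans (hfin K₂ (by nlinarith))
  · exact (integral_sq_le_of_cell_bound hpart hk (heu.deriv hpart) hg₁ hcw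
      (fun i hi t ht => (bound₂ i hi t ht).2) weight₁).trans (hfin K₂ (by nlinarith))
  · exact (integral_sq_le_of_cell_bound hpart hk hew.piecewiseCont hg₂ hcw
      bound₁ weight₂).trans (hfin K₁ (by nlinarith))

end layerBounds

/-! ### Galerkin orthogonality and the error estimate -/

section errorEstimate

variable {k N : ℕ} {x : ℕ → ℝ} {ε : ℝ} {b d f u : ℝ → ℝ}

/-- Nothing is assumed of $f$ directly, but the equation makes it agree on $(0,1)$ with a function
continuous on $[0,1]$. -/
theorem IsClampedSolution.piecewiseCont_rhs (hx : IsPartition N x)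
    (hb : ContinuousOn b unitI) (hd : ContinuousOn d unitI)
    (h : IsClampedSolution ε b d f u) : PiecewiseCont N x f := by
  have hu : ContDiffOn ℝ (4 : ℕ) u unitI := by exact_mod_cast h.smooth
  have hc : ContinuousOn (fun t => ε ^ 2 * derivI 4 u t - b t * derivI 2 u t + d t * u t) unitI :=
    ((continuousOn_const.mul (continuousOn_derivI hu le_rfl)).sub
      (hb.mul (continuousOn_derivI hu (by norm_num)))).add (hd.mul hu.continuousOn)
  exact (ContinuousOn.piecewiseCont hx hc).congr
    fun t ht => (h.equation t (hx.cellInteriors_subset ht)).symm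

theorem hasDerivAt_derivI_zero {r : ℕ} {v : ℝ → ℝ} (hv : ContDiffOn ℝ r v unitI) (hr : 0 < r)
    {t : ℝ} (ht : t ∈ Ioo (0 : ℝ) 1) : HasDerivAt v (derivI 1 v t) t := by
  have h := hasDerivAt_derivI hv hr ht
  rwa [derivI_zero] at h

/-- The exact solution satisfies the mixed formulation. -/
theorem IsClampedSolution.integral_mixedIntegrand (hx : IsPartition N x)
    (hb : ContDiffOn ℝ 2 b unitI) (hd : ContinuousOn d unitI)
    (h : IsClampedSolution ε b d f u) {ψ φ : ℝ → ℝ} (hψ : PiecewiseC1 N x ψ) (hψ0 : ψ 0 = 0)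
    (hψ1 : ψ 1 = 0) (hφ : PiecewiseC1 N x φ) :
    ∫ t in (0 : ℝ)..1, mixedIntegrand ε b d u (fun t => ε * derivI 2 u t) ψ φ t
      = ∫ t in (0 : ℝ)..1, f t * ψ t := by
  have hu : ContDiffOn ℝ (4 : ℕ) u unitI := by exact_mod_cast h.smooth
  have hb2 : ContDiffOn ℝ (2 : ℕ) b unitI := by exact_mod_cast hb
  have hb1 : PiecewiseC1 N x b := ContDiffOn.piecewiseC1 hx (hb.of_le (by norm_num))
  have hdp : PiecewiseCont N x d := ContinuousOn.piecewiseCont hx hd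
  have hf := h.piecewiseCont_rhs hx hb.continuousOn hd
  have pu0 : PiecewiseC1 N x u := ContDiffOn.piecewiseC1 hx (h.smooth.of_le (by norm_num))
  have pu : ∀ j < 4, PiecewiseC1 N x (derivI j u) := fun j hj =>
    ContDiffOn.piecewiseC1 hx (contDiffOn_derivI hu hj)
  have pw : PiecewiseC1 N x (fun t => ε * derivI 2 u t) := (pu 2 (by norm_num)).const_mul ε
  -- The mixed integrand minus $f\psi$ is the derivative of $\varepsilon
  -- u'\varphi+bu'\psi-\varepsilon^2u'''\psi$. Its end values vanish by $u'=0$ and $\psi=0$, so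
  -- $\varphi$ needs no boundary condition.
  have pZ : PiecewiseC1 N x (fun t => ε * (derivI 1 u t * φ t)
      + b t * (derivI 1 u t * ψ t) - ε ^ 2 * (derivI 3 u t * ψ t)) :=
    ((((pu 1 (by norm_num)).mul hφ).const_mul ε).add
      (hb1.mul ((pu 1 (by norm_num)).mul hψ))).sub
      (((pu 3 (by norm_num)).mul hψ).const_mul (ε ^ 2))
  have hZ := pZ.integral_deriv hx
  simp only [h.left_slope, h.right_slope, hψ0, hψ1, zero_mul, mul_zero, add_zero,
    sub_zero] at hZ
  have pM := piecewiseCont_mixedIntegrand hx ε hb1 hdp pu0 pw hψ hφ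
  have pF := hf.mul hψ.piecewiseCont
  rw [← sub_eq_zero, ← intervalIntegral.integral_sub (pM.intervalIntegrable hx)
    (pF.intervalIntegrable hx)]
  refine Eq.trans ?_ hZ
  refine (pZ.deriv hx).integral_congr hx fun t ht => ?_
  have ht' := hx.cellInteriors_subset ht
  have d1 := hasDerivAt_derivI_zero hu (by norm_num) ht'
  have d2 := hasDerivAt_derivI hu (j := 1) (by norm_num) ht'
  have d3 := hasDerivAt_derivI hu (j := 2) (by norm_num) ht'
  have d4 := hasDerivAt_derivI hu (j := 3) (by norm_num) ht'
  have db := hasDerivAt_derivI_zero hb2 (by norm_num) ht'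
  have dψ := (hψ.differentiableAt ht).hasDerivAt
  have dφ := (hφ.differentiableAt ht).hasDerivAt
  have dZ := (((d2.mul dφ).const_mul ε).add (db.mul (d2.mul dψ))).sub
    ((d4.mul dψ).const_mul (ε ^ 2))
  have eZ := dZ.deriv
  have eqn := h.equation t ht'
  have ew : deriv (fun t => ε * derivI 2 u t) t = ε * derivI 3 u t := (d3.const_mul ε).deriv
  refine Eq.trans ?_ eZ.symm
  simp only [mixedIntegrand, d1.deriv, db.deriv, ew, ← eqn, Pi.mul_apply]
  ring

/-- After passing to absolute values, the gap is the square $(c|z|-B|y|)^2/(2c)$. The weight $c/2$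
on $z^2$ is what coercivity can absorb. -/
theorem young_mul_le {a B c y z : ℝ} (ha : |a| ≤ B) (hc : 0 < c) :
    a * y * z ≤ c / 2 * z ^ 2 + B ^ 2 / (2 * c) * y ^ 2 := by
  have h1 : a * y * z ≤ B * |y| * |z| := by
    calc a * y * z ≤ |a * y * z| := le_abs_self _
      _ = |a| * |y| * |z| := by rw [abs_mul, abs_mul]
      _ ≤ B * |y| * |z| := by gcongr
  have h2 : c / 2 * z ^ 2 + B ^ 2 / (2 * c) * y ^ 2 - B * |y| * |z|
      = (c * |z| - B * |y|) ^ 2 / (2 * c) := by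
    rw [← sq_abs y, ← sq_abs z]
    field_simp
    ring
  have h3 : 0 ≤ (c * |z| - B * |y|) ^ 2 / (2 * c) := by positivity
  linarith

/-- The distance between the discrete solution and an interpolant that preserves the moments
`0, …, k - 2` is controlled by the interpolation error. -/
theorem exists_supercloseness (hb : ContDiffOn ℝ 2 b unitI) (hd : ContinuousOn d unitI)
    (hbpos : ∀ t ∈ unitI, 0 < b t) {δ : ℝ} (hδ : 0 < δ)
    (hbd : ∀ t ∈ unitI, δ < d t - derivI 2 b t / 2) :
    ∃ K : ℝ, 0 ≤ K ∧ ∀ (k N : ℕ) (x : ℕ → ℝ) (ε : ℝ) (f u uH wH pu pw : ℝ → ℝ),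
      IsPartition N x → IsClampedSolution ε b d f u →
      IsMixedFESolution k N x ε b d f uH wH → IsMomentInterpolant k 0 N x u pu →
      IsMomentInterpolant k 0 N x (fun t => ε * derivI 2 u t) pw →
      (∫ t in (0 : ℝ)..1, deriv (fun t => pu t - uH t) t ^ 2)
          + (∫ t in (0 : ℝ)..1, (pw t - wH t) ^ 2)
        ≤ K * ((∫ t in (0 : ℝ)..1, (pu t - u t) ^ 2)
          + (∫ t in (0 : ℝ)..1, deriv (fun t => pu t - u t) t ^ 2)
          + ∫ t in (0 : ℝ)..1, (pw t - ε * derivI 2 u t) ^ 2) := by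
  have hb2 : ContDiffOn ℝ (2 : ℕ) b unitI := by exact_mod_cast hb
  obtain ⟨t₀, ht₀, hmin⟩ := isCompact_Icc.exists_isMinOn (nonempty_Icc.2 zero_le_one)
    hb.continuousOn
  obtain ⟨B₁, hB₁⟩ := isCompact_Icc.exists_bound_of_continuousOn hb.continuousOn
  obtain ⟨B₂, hB₂⟩ := isCompact_Icc.exists_bound_of_continuousOn
    (continuousOn_derivI hb2 (j := 1) (by norm_num))
  obtain ⟨B₃, hB₃⟩ := isCompact_Icc.exists_bound_of_continuousOn hd
  set β := b t₀
  have hβ : 0 < β := hbpos t₀ ht₀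
  set B := max B₁ (max B₂ B₃)
  have hB1 : ∀ t ∈ unitI, |b t| ≤ B := fun t ht => (hB₁ t ht).trans (le_max_left _ _)
  have hB2 : ∀ t ∈ unitI, |derivI 1 b t| ≤ B := fun t ht =>
    (hB₂ t ht).trans ((le_max_left _ _).trans (le_max_right _ _))
  have hB3 : ∀ t ∈ unitI, |d t| ≤ B := fun t ht =>
    (hB₃ t ht).trans ((le_max_right _ _).trans (le_max_right _ _))
  -- What Young's inequality leaves of the coercivity constants: half of $\beta$ and half of 1. The
  -- whole of $\delta$ is spent, in two halves, on the terms with $b'$ and $d$.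
  set μ := min (β / 2) (1 / 2)
  have hμ : 0 < μ := lt_min (by linarith) (by norm_num)
  have hμ1 : μ ≤ β / 2 := min_le_left _ _
  have hμ2 : μ ≤ 1 / 2 := min_le_right _ _
  set L := 1 / 2 + B ^ 2 / (2 * β) + B ^ 2 / (2 * δ) with hL
  have q1 : 0 ≤ B ^ 2 / (2 * β) := by positivity
  have q2 : 0 ≤ B ^ 2 / (2 * δ) := by positivity
  refine ⟨L / μ, by positivity, ?_⟩
  intro k N x ε f u uH wH pu pw hx hsol hH hpu hpw
  have hb1 : PiecewiseC1 N x b := ContDiffOn.piecewiseC1 hx (hb.of_le (by norm_num))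
  have hdp : PiecewiseCont N x d := ContinuousOn.piecewiseCont hx hd
  have cu : PiecewiseC1 N x u := ContDiffOn.piecewiseC1 hx (hsol.smooth.of_le (by norm_num))
  have cw : PiecewiseC1 N x (fun t => ε * derivI 2 u t) :=
    (ContDiffOn.piecewiseC1 hx
      (contDiffOn_derivI (r := 4) (by exact_mod_cast hsol.smooth) (by norm_num))).const_mul ε
  have hξ := hpu.mem.sub hH.mem_u
  have hη := hpw.mem.sub hH.mem_w
  have cξ := hξ.piecewiseC1
  have cη := hη.piecewiseC1
  have pu0 : pu 0 = 0 := by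
    have := hpu.nodes 0 (Nat.zero_le N)
    rwa [hx.left, hsol.left_value] at this
  have pu1 : pu 1 = 0 := by
    have := hpu.nodes N le_rfl
    rwa [hx.right, hsol.right_value] at this
  have ξ0 : pu 0 - uH 0 = 0 := by rw [pu0, hH.left_value, sub_zero]
  have ξ1 : pu 1 - uH 1 = 0 := by rw [pu1, hH.right_value, sub_zero]
  have ce := hpu.mem.piecewiseC1.sub cu
  have cg := hpw.mem.piecewiseC1.sub cw
  have M₁ := piecewiseCont_mixedIntegrand hx ε hb1 hdp hpu.mem.piecewiseC1
    hpw.mem.piecewiseC1 cξ cη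
  have M₂ := piecewiseCont_mixedIntegrand hx ε hb1 hdp hH.mem_u.piecewiseC1
    hH.mem_w.piecewiseC1 cξ cη
  have M₃ := piecewiseCont_mixedIntegrand hx ε hb1 hdp cu cw cξ cη
  have I₁ := (M₁.sub M₂).integral_congr hx (mixedIntegrand_sub (ε := ε) (b := b) (d := d)
    hpu.mem.piecewiseC1 hpw.mem.piecewiseC1 hH.mem_u.piecewiseC1 hH.mem_w.piecewiseC1)
  have I₂ := (M₁.sub M₃).integral_congr hx (mixedIntegrand_sub (ε := ε) (b := b) (d := d)
    hpu.mem.piecewiseC1 hpw.mem.piecewiseC1 cu cw)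
  rw [intervalIntegral.integral_sub (M₁.intervalIntegrable hx) (M₂.intervalIntegrable hx),
    hH.integral_mixedIntegrand hx hb1 hdp hξ ξ0 ξ1 hη] at I₁
  rw [intervalIntegral.integral_sub (M₁.intervalIntegrable hx) (M₃.intervalIntegrable hx),
    hsol.integral_mixedIntegrand hx hb hd cξ ξ0 ξ1 cη] at I₂
  have hcoer := mixed_coercive (ε := ε) hx hb hd (fun t ht => hmin ht)
    (fun t ht => (hbd t ht).le) cξ cη ξ0 ξ1
  -- Discrete and exact pair give the same load $(f,\xi)$, so the form at $(\xi,\eta)$ is replaced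
  -- by the form at the interpolation errors.
  rw [I₁, ← I₂] at hcoer
  have o₁ := hpu.integral_deriv_mul_deriv hx cu hη
  have o₂ := hpw.integral_deriv_mul_deriv hx cw hξ
  set ξ := fun t => pu t - uH t
  set η := fun t => pw t - wH t
  set e := fun t => pu t - u t
  set g := fun t => pw t - ε * derivI 2 u t
  have dξ := cξ.deriv hx
  have dη := cη.deriv hx
  have de := ce.deriv hx
  have dg := cg.deriv hx
  have db := hb1.deriv hx
  have kξ := cξ.piecewiseCont
  have kη := cη.piecewiseCont
  have ke := ce.piecewiseCont
  have kg := cg.piecewiseCont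
  have kb := hb1.piecewiseCont
  have pc : ∀ c : ℝ, PiecewiseCont N x (fun _ => c) := PiecewiseCont.const
  have pM := piecewiseCont_mixedIntegrand hx ε hb1 hdp ce cg cξ cη
  have pO := ((pc ε).mul (de.mul dη)).sub ((pc ε).mul (dg.mul dξ))
  -- These are the only terms containing $\eta'$ or $g'$, which the norms in the estimate do not
  -- control; the preserved moments remove them.
  have hO : ∫ t in (0 : ℝ)..1, (ε * (deriv e t * deriv η t) - ε * (deriv g t * deriv ξ t)) = 0 := by
    rw [intervalIntegral.integral_sub (((pc ε).mul (de.mul dη)).intervalIntegrable hx)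
      (((pc ε).mul (dg.mul dξ)).intervalIntegrable hx), intervalIntegral.integral_const_mul,
      intervalIntegral.integral_const_mul, o₁, o₂]
    ring
  have pL := (((pc β).mul dξ.sq).add ((pc δ).mul kξ.sq)).add kη.sq
  have pX := dξ.sq.add kη.sq
  have pE := (ke.sq.add de.sq).add kg.sq
  -- The right side contains the full coercivity density, so comparison with `hcoer` cancels it and
  -- leaves $\mu(\|\xi'\|^2+\|\eta\|^2)\le L(\|e\|^2+\|e'\|^2+\|g\|^2)$.
  have hpoint : ∫ t in (0 : ℝ)..1, mixedIntegrand ε b d e g ξ η t ≤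
      ∫ t in (0 : ℝ)..1, (((ε * (deriv e t * deriv η t) - ε * (deriv g t * deriv ξ t))
        + (β * deriv ξ t ^ 2 + δ * ξ t ^ 2 + η t ^ 2))
        - μ * (deriv ξ t ^ 2 + η t ^ 2) + L * (e t ^ 2 + deriv e t ^ 2 + g t ^ 2)) := by
    refine pM.integral_mono hx (((pO.add pL).sub ((pc μ).mul pX)).add ((pc L).mul pE)) ?_
    intro t ht
    have ht' := hx.cellInteriors_subset ht
    have hI := Ioo_subset_Icc_self ht'
    have y1 := young_mul_le (y := deriv e t) (z := deriv ξ t) (hB1 t hI) hβ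
    have y2 := young_mul_le (y := deriv e t) (z := ξ t) (hB2 t hI) hδ
    have y3 := young_mul_le (y := e t) (z := ξ t) (hB3 t hI) hδ
    have y4 : g t * η t ≤ 1 / 2 * η t ^ 2 + 1 / 2 * g t ^ 2 := by
      nlinarith [sq_nonneg (g t - η t)]
    have y5 := mul_le_mul_of_nonneg_right hμ1 (sq_nonneg (deriv ξ t))
    have y6 := mul_le_mul_of_nonneg_right hμ2 (sq_nonneg (η t))
    have z1 := mul_nonneg q1 (sq_nonneg (e t))
    have z2 := mul_nonneg q1 (sq_nonneg (g t))
    have z3 := mul_nonneg q2 (sq_nonneg (g t))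
    have z4 := sq_nonneg (e t)
    have z5 := sq_nonneg (deriv e t)
    simp only [mixedIntegrand, (hasDerivAt_derivI_zero hb2 (by norm_num) ht').deriv, hL]
    linarith
  rw [intervalIntegral.integral_add
      (((pO.add pL).sub ((pc μ).mul pX)).intervalIntegrable hx)
      (((pc L).mul pE).intervalIntegrable hx),
    intervalIntegral.integral_sub ((pO.add pL).intervalIntegrable hx)
      (((pc μ).mul pX).intervalIntegrable hx),
    intervalIntegral.integral_add (pO.intervalIntegrable hx) (pL.intervalIntegrable hx), hO,
    intervalIntegral.integral_const_mul, intervalIntegral.integral_const_mul,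
    intervalIntegral.integral_add (dξ.sq.intervalIntegrable hx) (kη.sq.intervalIntegrable hx),
    intervalIntegral.integral_add ((ke.sq.add de.sq).intervalIntegrable hx)
      (kg.sq.intervalIntegrable hx),
    intervalIntegral.integral_add (ke.sq.intervalIntegrable hx)
      (de.sq.intervalIntegrable hx)] at hpoint
  rw [div_mul_eq_mul_div, le_div_iff₀ hμ]
  linarith

/-- A triangle inequality for the square of `pairNorm`. -/
theorem integral_pair_triangle (hx : IsPartition N x) {p q v w z y : ℝ → ℝ}
    (hp : PiecewiseC1 N x p) (hq : PiecewiseC1 N x q) (hv : PiecewiseC1 N x v)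
    (hw : PiecewiseC1 N x w) (hz : PiecewiseC1 N x z) (hy : PiecewiseC1 N x y) :
    (∫ t in (0 : ℝ)..1, deriv (fun t => v t - z t) t ^ 2)
        + (∫ t in (0 : ℝ)..1, (w t - y t) ^ 2)
      ≤ 2 * (((∫ t in (0 : ℝ)..1, deriv (fun t => p t - v t) t ^ 2)
        + ∫ t in (0 : ℝ)..1, (q t - w t) ^ 2)
        + ((∫ t in (0 : ℝ)..1, deriv (fun t => p t - z t) t ^ 2)
        + ∫ t in (0 : ℝ)..1, (q t - y t) ^ 2)) := by
  have a1 := ((hp.sub hv).deriv hx).sq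
  have a2 := ((hp.sub hz).deriv hx).sq
  have c1 := (hq.sub hw).piecewiseCont.sq
  have c2 := (hq.sub hy).piecewiseCont.sq
  have h1 := ((hv.sub hz).deriv hx).sq.integral_mono hx
    ((PiecewiseCont.const 2).mul (a1.add a2)) (fun t ht => by
      simp only [hv.deriv_sub hz ht, hp.deriv_sub hv ht, hp.deriv_sub hz ht]
      nlinarith [sq_nonneg ((deriv p t - deriv v t) + (deriv p t - deriv z t))])
  have h2 := (hw.sub hy).piecewiseCont.sq.integral_mono hx
    ((PiecewiseCont.const 2).mul (c1.add c2)) (fun t _ => by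
      nlinarith [sq_nonneg ((q t - w t) + (q t - y t))])
  rw [intervalIntegral.integral_const_mul, intervalIntegral.integral_add
    (a1.intervalIntegrable hx) (a2.intervalIntegrable hx)] at h1
  rw [intervalIntegral.integral_const_mul, intervalIntegral.integral_add
    (c1.intervalIntegrable hx) (c2.intervalIntegrable hx)] at h2
  linarith

theorem integral_pair_sub_comm (hx : IsPartition N x) {v w z y : ℝ → ℝ}
    (hv : PiecewiseC1 N x v) (hz : PiecewiseC1 N x z) :
    (∫ t in (0 : ℝ)..1, deriv (fun t => v t - z t) t ^ 2)
        + (∫ t in (0 : ℝ)..1, (w t - y t) ^ 2)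
      = (∫ t in (0 : ℝ)..1, deriv (fun t => z t - v t) t ^ 2)
        + ∫ t in (0 : ℝ)..1, (y t - w t) ^ 2 := by
  congr 1
  · refine ((hz.sub hv).deriv hx).sq.integral_congr hx fun t ht => ?_
    simp only [hv.deriv_sub hz ht, hz.deriv_sub hv ht]
    ring
  · congr 1
    funext t
    ring

/-- As $D\le(D+1)^2$, the constant $D+1$ spares the square root of $D$. -/
theorem pairNorm_le {v w : ℝ → ℝ} {D H : ℝ} (hD : 0 ≤ D) (hH : 0 ≤ H)
    (h : (∫ t in (0 : ℝ)..1, deriv v t ^ 2) + (∫ t in (0 : ℝ)..1, w t ^ 2) ≤ D * H ^ (2 * k)) :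
    pairNorm v w ≤ (D + 1) * H ^ k := by
  refine Real.sqrt_le_iff.2 ⟨by positivity, h.trans ?_⟩
  rw [mul_pow, ← pow_mul, mul_comm k 2]
  exact mul_le_mul_of_nonneg_right (by nlinarith) (by positivity)

end errorEstimate

/-! ### The main theorem -/

theorem mainTheorem1 (k : ℕ) (hk : 1 ≤ k) (b d : ℝ → ℝ) (δ α₁ C₀ : ℝ)
    (hb : ContDiffOn ℝ 2 b unitI) (hd : ContinuousOn d unitI)
    (hbpos : ∀ x ∈ unitI, 0 < b x) (hδ : 0 < δ)
    (hbd : ∀ x ∈ unitI, δ < d x - derivI 2 b x / 2) :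
    ∃ C : ℝ, 0 < C ∧
      ∀ (ε : ℝ) (f u S E₁ E₂ : ℝ → ℝ), 0 < ε →
        IsClampedSolution ε b d f u →
        IsLayerDecomposition (k + 2) C₀ ε u S E₁ E₂ →
      ∀ (α H h : ℝ) (n m : ℕ), α ≤ α₁ → IsLayerMesh k ε α H h n m →
      ∀ (N : ℕ) (x : ℕ → ℝ) (w : ℝ → ℝ), N = 2 * n + m →
        x = meshPoint (transitionPoint k ε) H h n m →
        w = (fun t => ε * derivI 2 u t) →
        -- the discrete problem has a unique solution
        (∃ uH wH : ℝ → ℝ, IsMixedFESolution k N x ε b d f uH wH) ∧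
        (∀ uH wH uH' wH' : ℝ → ℝ, IsMixedFESolution k N x ε b d f uH wH →
          IsMixedFESolution k N x ε b d f uH' wH' →
          Set.EqOn uH uH' unitI ∧ Set.EqOn wH wH' unitI) ∧
        ∀ s : ℕ, s ≤ 1 →
          -- the interpolant is well defined
          (∀ v : ℝ → ℝ, ContinuousOn v unitI →
            (∃ p : ℝ → ℝ, IsMomentInterpolant k s N x v p) ∧
            ∀ p q : ℝ → ℝ, IsMomentInterpolant k s N x v p →
              IsMomentInterpolant k s N x v q → Set.EqOn p q unitI) ∧
          -- the error estimates
          ∀ uH wH πu πw : ℝ → ℝ, IsMixedFESolution k N x ε b d f uH wH →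
            IsMomentInterpolant k s N x u πu → IsMomentInterpolant k s N x w πw →
            pairNorm (fun t => πu t - uH t) (fun t => πw t - wH t) ≤ C * H ^ k ∧
            pairNorm (fun t => u t - uH t) (fun t => w t - wH t) ≤ C * H ^ k := by
  obtain ⟨K₀, hK₀, herr₀⟩ := exists_layer_interpolation_error k 0 hk α₁ C₀
  obtain ⟨K₁, hK₁, herr₁⟩ := exists_layer_interpolation_error k 1 hk α₁ C₀
  obtain ⟨L, hL, hsuper⟩ := exists_supercloseness hb hd hbpos hδ hbd
  -- $D_0$ bounds the squared error of the discrete solution: $2K_0$ from interpolation,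
  -- $L\cdot3K_0$ from supercloseness, and a factor 2 from the triangle inequality. $D_1$ adds the
  -- interpolation error for either $s$ by a second triangle inequality.
  set D₀ : ℝ := 2 * (2 * K₀ + L * (3 * K₀)) with hD₀
  set D₁ : ℝ := 2 * (2 * (K₀ + K₁) + D₀) with hD₁
  have hD₀0 : 0 ≤ D₀ := by positivity
  have hD₁0 : 0 ≤ D₁ := by positivity
  refine ⟨D₁ + 1, by positivity, ?_⟩
  intro ε f u S E₁ E₂ hε hsol hdec α H h n m hα hM N x w hN hx hw
  subst hN
  have hpart : IsPartition (2 * n + m) x := hx ▸ hM.isPartition hε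
  have hf : PiecewiseCont (2 * n + m) x f :=
    hsol.piecewiseCont_rhs hpart hb.continuousOn hd
  refine ⟨exists_mixedFESolution hpart hb hd hbpos hδ hbd hf,
    fun uH wH uH' wH' h1 h2 => h1.unique hpart hb hd hbpos hδ hbd h2, fun s hs => ⟨?_, ?_⟩⟩
  · exact fun v _ => ⟨exists_momentInterpolant hk s hpart v, fun p q hp hq => hp.eqOn hpart hq⟩
  · intro uH wH πu πw hH hπu hπw
    rw [hw] at hπw ⊢
    have hHpos := hM.H_pos
    have cu : PiecewiseC1 (2 * n + m) x u :=
      ContDiffOn.piecewiseC1 hpart (hsol.smooth.of_le (by norm_num))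
    have cw : PiecewiseC1 (2 * n + m) x (fun t => ε * derivI 2 u t) :=
      (ContDiffOn.piecewiseC1 hpart
        (contDiffOn_derivI (r := 4) (by exact_mod_cast hsol.smooth) (by norm_num))).const_mul ε
    -- The interpolant for $s=0$ serves as an auxiliary function whatever $s$ is, because
    -- supercloseness is available for it.
    obtain ⟨pu, hpu⟩ := exists_momentInterpolant hk 0 hpart u
    obtain ⟨pw, hpw⟩ := exists_momentInterpolant hk 0 hpart (fun t => ε * derivI 2 u t)
    obtain ⟨a1, a2, a3⟩ := herr₀ ε u S E₁ E₂ hε hsol.smooth hdec α H h n m hα hM x pu pw hx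
      hpu hpw
    have hclose := hsuper k (2 * n + m) x ε f u uH wH pu pw hpart hsol hH hpu hpw
    have hclose' := hclose.trans (mul_le_mul_of_nonneg_left
      (add_le_add (add_le_add a1 a2) a3) hL)
    have herr := integral_pair_triangle hpart hpu.mem.piecewiseC1 hpw.mem.piecewiseC1 cu cw
      hH.mem_u.piecewiseC1 hH.mem_w.piecewiseC1
    have hfirst : (∫ t in (0 : ℝ)..1, deriv (fun t => u t - uH t) t ^ 2)
        + (∫ t in (0 : ℝ)..1, (ε * derivI 2 u t - wH t) ^ 2) ≤ D₀ * H ^ (2 * k) := by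
      rw [hD₀]
      linarith
    have hinterp : (∫ t in (0 : ℝ)..1, deriv (fun t => πu t - u t) t ^ 2)
        + (∫ t in (0 : ℝ)..1, (πw t - ε * derivI 2 u t) ^ 2)
          ≤ 2 * (K₀ + K₁) * H ^ (2 * k) := by
      have n0 : 0 ≤ K₀ * H ^ (2 * k) := by positivity
      have n1 : 0 ≤ K₁ * H ^ (2 * k) := by positivity
      obtain rfl | rfl : s = 0 ∨ s = 1 := by omega
      · obtain ⟨-, b2, b3⟩ := herr₀ ε u S E₁ E₂ hε hsol.smooth hdec α H h n m hα hM x πu πw hx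
          hπu hπw
        linarith
      · obtain ⟨-, b2, b3⟩ := herr₁ ε u S E₁ E₂ hε hsol.smooth hdec α H h n m hα hM x πu πw hx
          hπu hπw
        linarith
    rw [integral_pair_sub_comm hpart hπu.mem.piecewiseC1 cu] at hinterp
    have htri := integral_pair_triangle hpart cu cw hπu.mem.piecewiseC1 hπw.mem.piecewiseC1
      hH.mem_u.piecewiseC1 hH.mem_w.piecewiseC1
    have hHk : 0 ≤ H ^ (2 * k) := by positivity
    refine ⟨pairNorm_le hD₁0 hHpos.le ?_, pairNorm_le hD₁0 hHpos.le (hfirst.trans ?_)⟩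
    · rw [hD₁]
      linarith
    · refine mul_le_mul_of_nonneg_right ?_ hHk
      rw [hD₁]
      linarith
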